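/- **Theorem.** Let $k$ be a real quadratic field with ring of integers $\mathcal O$ and real embeddings $\iota_1,\iota_2$. Let $\mathfrak f\neq\mathcal O$ be an ideal of $\mathcal O$ with $\mathfrak f\cap\mathbb Z=f\mathbb Z$, $f\in\mathbb Z_{>0}$. Let $I$ be a (non-zero) fractional ideal of $k$ and $\xi:I\to\mathbb C^\times$ a character of its additive group whose values are roots of unity and whose annihilator $\{a\in\mathcal O:\xi(ax)=1\ \forall x\in I\}$ is $\mathfrak f$. Let $\tau_1,\tau_2\in I$ be totally positive, linearly independent over $\mathbb Q$, with $\xi(\tau_1)\neq1$ and $\xi(\tau_2)\neq 1$, and let $p$ be a prime number with $p\mathcal O+\mathfrak f=\mathcal O$. Put $$C(\tau_1,\tau_2)=\{\lambda\tau_1+\mu\tau_2:\lambda,\mu\in\mathbb Q,\ \lambda>0,\ \mu\ge0\},$$ $$P(\tau_1,\tau_2)=\{\lambda\tau_1+\mu\tau_2:\lambda,\mu\in\mathbb Q,\ 0<\lambda\le1,\ 0\le\mu<1\}.$$ For $\Re(s)>1$ define $$z_{T_p}(s;\xi,I,\tau_1,\tau_2)=\sum_{a\in I\cap C(\tau_1,\tau_2),\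 p\nmid|I:(a)|}\frac{\xi(a)}{(\iota_1(a)\iota_2(a))^s},$$ where $(a)=a\mathcal O$. For either ordering $\underline\iota$ of the two real embeddings, let $(1+\underline X)^{\underline\iota(a)}$ be the product of formal binomial series $(1+X_1)^{\iota_1(a)}(1+X_2)^{\iota_2(a)}$ (with $\iota_1,\iota_2$ taken in the order $\underline\iota$), let $\Delta=(1+X_1)(1+X_2)\frac{\partial^2}{\partial X_1\partial X_2}$, and put $$F_{T_p,\underline\iota}(\underline X;\xi,I,\tau_1,\tau_2)=\frac{\sum_{\tilde a\in I\cap P(p\tau_1,p\tau_2),\ p\nmid|I:(\tilde a)|}\xi(\tilde a)(1+\underline X)^{\underline\iota(\tilde a)}}{(1-\xi(p\tau_1)(1+\underline X)^{\underline\iota(p\tau_1)})(1-\xi(p\tau_2)(1+\underline X)^{\underline\iota(p\tau_2)})}.$$ Then the sum in the numerator is finite and $\xi(p\tau_1),\xi(p\tau_2)\neq1$, so that $F_{T_p,\underline\iota}$ is a well-defined formal power series in $X_1,X_2$, and moreover: 1. The series $z_{T_p}(s;\xi,I,\tau_1,\tau_2)$ converges absolutely for $\Re(s)>1$, is analytic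 there, and possesses a meromorphic continuation to $\mathbb C$. 2. For each integer $m\le0$ this continuation is analytic at $m$ and, for either ordering $\underline\iota$, $$z_{T_p}(m;\xi,I,\tau_1,\tau_2)=\Delta^{-m}F_{T_p,\underline\iota}(\underline X;\xi,I,\tau_1,\tau_2)\big|_{\underline X=0}.$$ 3. $z_{T_p}(m;\xi,I,\tau_1,\tau_2)\in\mathbb Q(\mu_f)$ for every integer $m\le0$, where $\mu_f\subset\mathbb C$ is the group of $f$-th roots of unity. -/

import Mathlib

open scoped NumberField nonZeroDivisors

noncomputable section

namespace ConeZeta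

variable {k : Type*} [Field k] [NumberField k]

/-- The annihilator `{a ∈ 𝓞 k : ξ(ax) = 1 for all x ∈ I}` of an additive character `ξ` on the
`𝓞 k`-submodule `I` of `k`. -/
def annihilator (I : Submodule (𝓞 k) k) (ξ : AddChar I ℂ) : Ideal (𝓞 k) where
  carrier := {a | ∀ x : I, ξ (a • x) = 1}
  zero_mem' := fun x => by rw [zero_smul, AddChar.map_zero_eq_one]
  add_mem' := fun {a b} ha hb x => by
    rw [add_smul, AddChar.map_add_eq_mul, ha x, hb x, one_mul]
  smul_mem' := fun c a ha x => by
    rw [smul_eq_mul, mul_comm, mul_smul]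
    exact ha (c • x)

/-- `a` is totally positive: it is positive under every real embedding. -/
def TotallyPositive (a : k) : Prop := ∀ σ : k →+* ℝ, 0 < σ a

/-- The half-open rational parallelogram `P(τ₁, τ₂)`. -/
def parallelogram (τ₁ τ₂ : k) : Set k :=
  {a | ∃ l m : ℚ, 0 < l ∧ l ≤ 1 ∧ 0 ≤ m ∧ m < 1 ∧ a = l • τ₁ + m • τ₂}

/-- The half-open rational cone `C(τ₁, τ₂)`. -/
def cone (τ₁ τ₂ : k) : Set k :=
  {a | ∃ l m : ℚ, 0 < l ∧ 0 ≤ m ∧ a = l • τ₁ + m • τ₂}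

/-- The index `|I : (a)|` of the principal fractional ideal `(a) = 𝓞 k · a` in `I`, for `a ∈ I`. -/
def idealIndex (I : Submodule (𝓞 k) k) (a : I) : ℕ :=
  (Submodule.span (𝓞 k) {a}).toAddSubgroup.index

/-- The elements `a` of `I ∩ C(τ₁, τ₂)` with `p ∤ |I : (a)|`. -/
def depletedCone (p : ℕ) (I : Submodule (𝓞 k) k) (τ₁ τ₂ : I) : Set I :=
  {a | (a : k) ∈ cone (τ₁ : k) (τ₂ : k) ∧ ¬ p ∣ idealIndex I a}

/-- The elements `a` of `I ∩ P(pτ₁, pτ₂)` with `p ∤ |I : (a)|`. -/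
def depletedParallelogram (p : ℕ) (I : Submodule (𝓞 k) k) (τ₁ τ₂ : I) : Set I :=
  {a | (a : k) ∈ parallelogram ((p • τ₁ : I) : k) ((p • τ₂ : I) : k) ∧ ¬ p ∣ idealIndex I a}

/-- The summand `ξ(a) / (ι₁(a) ι₂(a))^s`, where `ι 0 = ι₁` and `ι 1 = ι₂`. -/
def zetaTerm (ι : Fin 2 ≃ (k →+* ℝ)) (I : Submodule (𝓞 k) k) (ξ : AddChar I ℂ) (s : ℂ)
    (a : I) : ℂ :=
  ξ a / ((ι 0 (a : k) * ι 1 (a : k) : ℝ) : ℂ) ^ s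

/-- The Dirichlet series `z_{T_p}(s; ξ, I, τ₁, τ₂)`. -/
def depletedZeta (ι : Fin 2 ≃ (k →+* ℝ)) (p : ℕ) (I : Submodule (𝓞 k) k) (ξ : AddChar I ℂ)
    (τ₁ τ₂ : I) (s : ℂ) : ℂ :=
  ∑' a : depletedCone p I τ₁ τ₂, zetaTerm ι I ξ s a

/-- The product `(1 + X₁)^{u₁} (1 + X₂)^{u₂}` of two formal binomial series, given by its
coefficients: that of `X₁^i X₂^j` is `choose(u₁, i) * choose(u₂, j)`. -/
def onePlusXPow (u : Fin 2 → ℝ) : MvPowerSeries (Fin 2) ℂ :=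
  fun n => ((Ring.choose (u 0) (n 0) * Ring.choose (u 1) (n 1) : ℝ) : ℂ)

/-- The vector `(ι₁(a), ι₂(a))`. -/
def embVec (ι : Fin 2 ≃ (k →+* ℝ)) (a : k) : Fin 2 → ℝ := fun i => ι i a

/-- The formal power series `F_{T_p, ι}(X; ξ, I, τ₁, τ₂)`. The inverse is the one in the ring of
formal power series; it is meaningful when the constant term
`(1 - ξ(pτ₁)) (1 - ξ(pτ₂))` is non-zero. -/
def depletedSeries (ι : Fin 2 ≃ (k →+* ℝ)) (p : ℕ) (I : Submodule (𝓞 k) k) (ξ : AddChar I ℂ)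
    (τ₁ τ₂ : I) : MvPowerSeries (Fin 2) ℂ :=
  (∑ᶠ a ∈ depletedParallelogram p I τ₁ τ₂, ξ a • onePlusXPow (embVec ι (a : k))) *
    ((1 - ξ (p • τ₁) • onePlusXPow (embVec ι ((p • τ₁ : I) : k))) *
      (1 - ξ (p • τ₂) • onePlusXPow (embVec ι ((p • τ₂ : I) : k))))⁻¹

/-- The differential operator `Δ = (1 + X₁) (1 + X₂) ∂² / ∂X₁ ∂X₂`. -/
def Delta (F : MvPowerSeries (Fin 2) ℂ) : MvPowerSeries (Fin 2) ℂ :=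
  (1 + MvPowerSeries.X 0) * (1 + MvPowerSeries.X 1) *
    MvPowerSeries.pderiv ℂ 0 (MvPowerSeries.pderiv ℂ 1 F)

/-- The subfield `ℚ(μ_f)` of `ℂ` generated by the `f`-th roots of unity. -/
def cyclotomicSubfield (f : ℕ) : IntermediateField ℚ ℂ :=
  IntermediateField.adjoin ℚ {ζ : ℂ | ζ ^ f = 1}

end ConeZeta

end

/-! Whether `p` divides `|I : (a)|` depends only on `a` modulo `pI`, because non-divisibility means
`(a) + pI = I`. Hence the depleted cone is the disjoint union of the translates of the finite
depleted parallelogram by `ℕ pτ₁ + ℕ pτ₂` (`depletedConeEquiv`). So the zeta function is a finite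
combination of series `∑ z^m w^n (L₀(m,n) L₁(m,n))^(-s)`, where the `Lᵢ` are positive linear forms
and `z = ξ(pτ₁)`, `w = ξ(pτ₂)`. These are `f`-th roots of unity, and they differ from 1 because `p`
is prime to `f`.

Since `z, w ≠ 1`, Abel summation (`tsum_prod_pow_mul_eq`) trades the summand for its `K`-th
differences plus boundary terms. Each difference gains one power of decay
(`norm_fwdDiff_kernel_le`), so the rewritten series is holomorphic for `2 Re s + K > 2`. Letting `K`
grow and gluing by the identity theorem gives a continuation that is even entire
(`exists_entire_coneSum`). At `s = -n` the summand is a polynomial of degree at most `2n` in each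
variable. For large `K` the remainders vanish, and a finite double sum of differences of `N^n` at
the origin is left.

The formal side yields the same sum (`deltaValue_cone_series`). Expanding `(1 - zA)⁻¹` in powers of
`A - 1` produces the Abel coefficients. The functional `F ↦ (Δ^n F)(0)` turns multiplication by `A -
1` into a forward difference, and it ignores terms of order above `2n`. Finally, `L₀ L₁` takes
values of the rational field norm. This makes the result independent of the ordering of the
embeddings and places it in `ℚ(μ_f)`. -/

noncomputable section

namespace ConeZeta

open Finset

/-! ### Formal binomial series and the functional `F ↦ (Δ^n F)(0)` -/

section FormalSeries

open MvPowerSeries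

/-- `abelCoeff z j` is the coefficient of the `j`-th difference in repeated Abel summation against
`m ↦ z ^ m`. -/
def abelCoeff (z : ℂ) (j : ℕ) : ℂ := (z / (1 - z)) ^ j / (1 - z)

/-- `Delta` as a linear map. -/
def DeltaLinear : MvPowerSeries (Fin 2) ℂ →ₗ[ℂ] MvPowerSeries (Fin 2) ℂ where
  toFun := Delta
  map_add' F G := by simp [Delta, mul_add]
  map_smul' c F := by simp [Delta]

/-- The linear functional `F ↦ (Δ ^ n F)(0)`. -/
def deltaValue (n : ℕ) : MvPowerSeries (Fin 2) ℂ →ₗ[ℂ] ℂ :=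
  (MvPowerSeries.coeff (R := ℂ) (0 : Fin 2 →₀ ℕ)) ∘ₗ (DeltaLinear ^ n)

theorem deltaValue_apply (n : ℕ) (F : MvPowerSeries (Fin 2) ℂ) :
    deltaValue n F = constantCoeff (Delta^[n] F) := by
  simp only [deltaValue, LinearMap.comp_apply, Module.End.pow_apply]
  rfl

/-- `U` behaves like `(1 + X₀) ^ u₀ * (1 + X₁) ^ u₁` under the operators `(1 + Xᵢ) ∂ᵢ`. -/
structure HasExponent (U : MvPowerSeries (Fin 2) ℂ) (u : Fin 2 → ℝ) : Prop where
  constantCoeff_eq : constantCoeff U = 1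
  one_add_X_mul_pderiv : ∀ i, (1 + X i) * pderiv ℂ i U = (u i : ℂ) • U

theorem HasExponent.mul {U V : MvPowerSeries (Fin 2) ℂ} {u v : Fin 2 → ℝ} (hU : HasExponent U u)
    (hV : HasExponent V v) : HasExponent (U * V) (u + v) where
  constantCoeff_eq := by simp [hU.1, hV.1]
  one_add_X_mul_pderiv i := by
    have h1 := hU.2 i
    have h2 := hV.2 i
    simp only [MvPowerSeries.smul_eq_C_mul] at h1 h2 ⊢
    simp only [Derivation.leibniz, smul_eq_mul, Pi.add_apply, Complex.ofReal_add, map_add]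
    linear_combination V * h1 + U * h2

/-- `Δ` is the composite of the operators `(1 + Xᵢ) ∂ᵢ`, since `∂₀` kills `1 + X₁`; `U` is a common
eigenvector of both. -/
theorem HasExponent.delta_eq {U : MvPowerSeries (Fin 2) ℂ} {u : Fin 2 → ℝ}
    (hU : HasExponent U u) : Delta U = ((u 0 * u 1 : ℝ) : ℂ) • U := by
  have h0 := hU.2 0
  have h1 := hU.2 1
  have h2 := congrArg (pderiv ℂ 0) h1
  simp only [MvPowerSeries.smul_eq_C_mul] at h0 h1 h2 ⊢
  have hX : pderiv ℂ 0 (X 1 : MvPowerSeries (Fin 2) ℂ) = 0 := pderiv_X_of_ne (by decide)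
  simp only [Derivation.leibniz, smul_eq_mul, map_add, pderiv_one, hX, pderiv_C] at h2
  rw [Delta, Complex.ofReal_mul, map_mul]
  linear_combination (1 + X 0) * h2 + C (u 1 : ℂ) * h0

theorem HasExponent.deltaValue_eq {U : MvPowerSeries (Fin 2) ℂ} {u : Fin 2 → ℝ}
    (hU : HasExponent U u) (n : ℕ) : deltaValue n U = ((u 0 * u 1 : ℝ) : ℂ) ^ n := by
  have h : Delta^[n] U = ((u 0 * u 1 : ℝ) : ℂ) ^ n • U := by
    induction n with
    | zero => simp
    | succ n ih =>
      rw [Function.iterate_succ_apply', ih]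
      have := DeltaLinear.map_smul (((u 0 * u 1 : ℝ) : ℂ) ^ n) U
      change Delta _ = _ • Delta U at this
      rw [this, hU.delta_eq, smul_smul, pow_succ]
  rw [deltaValue_apply, h]
  simp [hU.1]

/-- This recurrence is the differential equation `(1 + X) F' = r F` of the binomial series, read off
on coefficients. -/
theorem succ_mul_ringChoose_succ (r : ℝ) (n : ℕ) :
    Ring.choose r (n + 1) * (n + 1) = (r - n) * Ring.choose r n := by
  rw [Ring.choose_eq_smul, Ring.choose_eq_smul, descPochhammer_succ_right]
  simp only [Polynomial.smeval_mul, Polynomial.smeval_sub, Polynomial.smeval_X,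
    Polynomial.smeval_natCast, Nat.factorial_succ]
  have : ((n.factorial : ℕ) : ℝ) ≠ 0 := by positivity
  have : (n + 1 : ℝ) ≠ 0 := by positivity
  simp
  field_simp

theorem coeff_one_add_X_mul_pderiv (i : Fin 2) (F : MvPowerSeries (Fin 2) ℂ) (n : Fin 2 →₀ ℕ) :
    coeff n ((1 + X i) * pderiv ℂ i F) =
      coeff (n + Finsupp.single i 1) F * (n i + 1) + coeff n F * n i := by
  rw [add_mul, one_mul, map_add, coeff_pderiv]
  congr 1
  by_cases h : n i = 0
  · rw [h, Nat.cast_zero, mul_zero, X, coeff_monomial_mul, if_neg]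
    intro hle
    have := hle i
    simp [h] at this
  · have hle : Finsupp.single i 1 ≤ n := by
      rw [Finsupp.single_le_iff]; omega
    obtain ⟨m, rfl⟩ := exists_add_of_le hle
    rw [X, coeff_add_monomial_mul, one_mul, coeff_pderiv, add_comm m]
    simp [add_comm]

theorem coeff_onePlusXPow (u : Fin 2 → ℝ) (n : Fin 2 →₀ ℕ) :
    coeff n (onePlusXPow u) = ((Ring.choose (u 0) (n 0) * Ring.choose (u 1) (n 1) : ℝ) : ℂ) :=
  rfl

theorem hasExponent_onePlusXPow (u : Fin 2 → ℝ) : HasExponent (onePlusXPow u) u where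
  constantCoeff_eq := by
    rw [← coeff_zero_eq_constantCoeff_apply, coeff_onePlusXPow]
    simp
  one_add_X_mul_pderiv i := by
    ext n
    rw [coeff_one_add_X_mul_pderiv, map_smul]
    simp only [coeff_onePlusXPow, smul_eq_mul]
    norm_cast
    fin_cases i
    · have h := succ_mul_ringChoose_succ (u 0) (n 0)
      simp at h ⊢
      linear_combination Ring.choose (u 1) (n 1) * h
    · have h := succ_mul_ringChoose_succ (u 1) (n 1)
      simp at h ⊢
      linear_combination Ring.choose (u 0) (n 0) * h

theorem le_order_pderiv {F : MvPowerSeries (Fin 2) ℂ} {K : ℕ}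
    (hF : (K + 1 : ℕ) ≤ F.order) (i : Fin 2) : (K : ℕ∞) ≤ (pderiv ℂ i F).order := by
  refine nat_le_order fun d hd => ?_
  rw [coeff_pderiv, coeff_of_lt_order, zero_mul]
  refine lt_of_lt_of_le ?_ hF
  rw [map_add, Finsupp.degree_single]
  exact_mod_cast Nat.succ_lt_succ hd

theorem le_order_Delta {F : MvPowerSeries (Fin 2) ℂ} {K : ℕ}
    (hF : (K + 2 : ℕ) ≤ F.order) : (K : ℕ∞) ≤ (Delta F).order := by
  have h := le_order_pderiv (le_order_pderiv hF 1) 0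
  exact h.trans (le_add_self.trans le_order_mul)

/-- Each `Δ` differentiates twice, so it lowers the order by at most 2, and a positive order
survives `n` applications. -/
theorem deltaValue_eq_zero_of_lt_order {F : MvPowerSeries (Fin 2) ℂ} {n K : ℕ} (hK : 2 * n < K)
    (hF : (K : ℕ∞) ≤ F.order) : deltaValue n F = 0 := by
  rw [deltaValue_apply]
  induction n generalizing F K with
  | zero =>
    rw [Function.iterate_zero_apply, ← one_le_order_iff_constCoeff_eq_zero]
    exact le_trans (by exact_mod_cast hK) hF
  | succ n ih =>
    rw [Function.iterate_succ_apply]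
    obtain ⟨K, rfl⟩ : ∃ J, K = J + 2 := ⟨K - 2, by omega⟩
    exact ih (K := K) (by omega) (le_order_Delta hF)

/-- The norm form `∏ᵢ (uᵢ + aᵢ t + bᵢ y)` raised to the power `n`. -/
def normFormPow (u a b : Fin 2 → ℝ) (n : ℕ) (t y : ℝ) : ℂ :=
  (((u 0 + a 0 * t + b 0 * y) * (u 1 + a 1 * t + b 1 * y) : ℝ) : ℂ) ^ n

/-- Multiplying by `A` shifts the exponent `u` by `a`, that is, `t` by 1; multiplying by `A - 1` is
therefore a forward difference in `t`. -/
theorem deltaValue_mul_sub_one_pow {U A : MvPowerSeries (Fin 2) ℂ} {u a : Fin 2 → ℝ}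
    (hU : HasExponent U u) (hA : HasExponent A a) (n j : ℕ) (b : Fin 2 → ℝ) :
    deltaValue n (U * (A - 1) ^ j) =
      (fwdDiff (1 : ℝ))^[j] (fun t => normFormPow u a b n t 0) 0 := by
  induction j generalizing U u with
  | zero => simp [hU.deltaValue_eq, normFormPow]
  | succ j ih =>
    have h : U * (A - 1) ^ (j + 1) = U * A * (A - 1) ^ j - U * (A - 1) ^ j := by ring
    rw [h, map_sub, ih hU, ih (hU.mul hA), Function.iterate_succ_apply', fwdDiff,
      ← fwdDiff_iter_comp_add]
    congr 1
    refine congrArg (fun f => (fwdDiff (1 : ℝ))^[j] f 0) (funext fun t => ?_)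
    simp only [normFormPow, Pi.add_apply]
    ring_nf

theorem deltaValue_mul_sub_one_pow_mul {U A B : MvPowerSeries (Fin 2) ℂ} {u a b : Fin 2 → ℝ}
    (hU : HasExponent U u) (hA : HasExponent A a) (hB : HasExponent B b) (n j l : ℕ) :
    deltaValue n (U * (A - 1) ^ j * (B - 1) ^ l) =
      (fwdDiff (1 : ℝ))^[l]
        (fun y => (fwdDiff (1 : ℝ))^[j] (fun t => normFormPow u a b n t y) 0) 0 := by
  induction l generalizing U u with
  | zero => simpa using deltaValue_mul_sub_one_pow hU hA n j b
  | succ l ih =>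
    have h : U * (A - 1) ^ j * (B - 1) ^ (l + 1) =
      U * B * (A - 1) ^ j * (B - 1) ^ l - U * (A - 1) ^ j * (B - 1) ^ l := by ring
    rw [h, map_sub, ih hU, ih (hU.mul hB), Function.iterate_succ_apply', fwdDiff,
      ← fwdDiff_iter_comp_add]
    congr 1
    refine congrArg (fun f => (fwdDiff (1 : ℝ))^[l] f 0) (funext fun y => ?_)
    refine congrArg (fun f => (fwdDiff (1 : ℝ))^[j] f 0) (funext fun t => ?_)
    simp only [normFormPow, Pi.add_apply]
    ring_nf

/-- Write `1 - zA = (1 - z) - z(A - 1)` and expand geometrically: this is the formal counterpart of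
Abel summation, with the same coefficients and remainder factor. -/
theorem inv_one_sub_smul_eq {A : MvPowerSeries (Fin 2) ℂ} (hA : constantCoeff A = 1) {z : ℂ}
    (hz : z ≠ 1) (K : ℕ) :
    (1 - z • A)⁻¹ = ∑ j ∈ range K, abelCoeff z j • (A - 1) ^ j +
      (A - 1) ^ K * ((z / (1 - z)) ^ K • (1 - z • A)⁻¹) := by
  have hz' : 1 - z ≠ 0 := sub_ne_zero.2 hz.symm
  have hc : constantCoeff (1 - z • A) ≠ 0 := by simpa [hA] using hz'
  have hinv := MvPowerSeries.mul_inv_cancel _ hc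
  induction K with
  | zero => simp
  | succ K ih =>
    generalize (1 - z • A)⁻¹ = J at ih hinv ⊢
    have key : (z / (1 - z)) ^ K • J = abelCoeff z K • 1 +
        (A - 1) * ((z / (1 - z)) ^ (K + 1) • J) := by
      simp only [MvPowerSeries.smul_eq_C_mul] at hinv ⊢
      have e1 : C (σ := Fin 2) ((z / (1 - z)) ^ K) = C (abelCoeff z K) * (1 - C z) := by
        rw [← map_one C, ← map_sub, ← map_mul, abelCoeff, div_mul_cancel₀ _ hz']
      have e2 : C (σ := Fin 2) ((z / (1 - z)) ^ (K + 1)) = C (abelCoeff z K) * C z := by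
        rw [← map_mul, abelCoeff]; congr 1; rw [pow_succ]; ring
      rw [e1, e2]
      linear_combination C (abelCoeff z K) * hinv
    rw [key, mul_add, ← add_assoc] at ih
    rw [sum_range_succ, pow_succ, mul_assoc]
    simpa using ih

/-- The value at `0` of `Δ ^ n` applied to a cone generating series. -/
theorem deltaValue_cone_series {U A B : MvPowerSeries (Fin 2) ℂ} {u a b : Fin 2 → ℝ}
    (hU : HasExponent U u) (hA : HasExponent A a) (hB : HasExponent B b) {z w : ℂ}
    (hz : z ≠ 1) (hw : w ≠ 1) {n K : ℕ} (hK : 2 * n < K) :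
    deltaValue n (U * ((1 - z • A) * (1 - w • B))⁻¹) =
      ∑ j ∈ range K, ∑ l ∈ range K, abelCoeff z j * abelCoeff w l *
        (fwdDiff (1 : ℝ))^[l]
          (fun y => (fwdDiff (1 : ℝ))^[j] (fun t => normFormPow u a b n t y) 0) 0 := by
  have hA' : (K : ℕ∞) ≤ ((A - 1) ^ K).order :=
    le_order_pow_of_constantCoeff_eq_zero _ (by simp [hA.1])
  have hB' : (K : ℕ∞) ≤ ((B - 1) ^ K).order :=
    le_order_pow_of_constantCoeff_eq_zero _ (by simp [hB.1])
  have hz2 (V W : MvPowerSeries (Fin 2) ℂ) (hV : (K : ℕ∞) ≤ V.order) :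
      deltaValue n (V * W) = 0 :=
    deltaValue_eq_zero_of_lt_order hK (hV.trans (le_self_add.trans le_order_mul))
  set R := (z / (1 - z)) ^ K • (1 - z • A)⁻¹ with hR
  set S := (w / (1 - w)) ^ K • (1 - w • B)⁻¹ with hS
  set P := ∑ j ∈ range K, abelCoeff z j • (A - 1) ^ j with hP
  set Q := ∑ j ∈ range K, abelCoeff w j • (B - 1) ^ j with hQ
  -- Apart from `U * (P * Q)`, every term contains `(A - 1) ^ K` or `(B - 1) ^ K`, hence has order
  -- at least `K > 2n` and is not seen by `deltaValue n`.
  have e : U * ((1 - z • A) * (1 - w • B))⁻¹ =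
      U * (P * Q) + (A - 1) ^ K * (R * U * Q + U * R * (B - 1) ^ K * S) +
        (B - 1) ^ K * (U * P * S) := by
    rw [MvPowerSeries.mul_inv_rev, inv_one_sub_smul_eq hA.1 hz K,
      inv_one_sub_smul_eq hB.1 hw K, ← hR, ← hS, ← hP, ← hQ]
    ring
  rw [e, map_add, map_add, hz2 _ _ hA', hz2 _ _ hB', add_zero, add_zero, hP, hQ, sum_mul_sum,
    mul_sum, map_sum]
  refine sum_congr rfl fun j _ => ?_
  rw [mul_sum, map_sum]
  refine sum_congr rfl fun l _ => ?_
  rw [smul_mul_smul_comm, mul_smul_comm, map_smul, smul_eq_mul, ← mul_assoc U,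
    deltaValue_mul_sub_one_pow_mul hU hA hB]

end FormalSeries

/-! ### The kernel and the decay of its differences -/

/-- The linear form `uᵢ + aᵢ t + bᵢ y`. -/
def linForm (u a b : Fin 2 → ℝ) (i : Fin 2) (t y : ℝ) : ℝ := u i + a i * t + b i * y

/-- The function `L₀ ^ (-s₁) * L₁ ^ (-s₂)` for the linear forms `Lᵢ = uᵢ + aᵢ t + bᵢ y`. -/
def kernel (u a b : Fin 2 → ℝ) (s₁ s₂ : ℂ) (t y : ℝ) : ℂ :=
  (linForm u a b 0 t y : ℂ) ^ (-s₁) * (linForm u a b 1 t y : ℂ) ^ (-s₂)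

section Decay

/-- Two-sided comparability of `x` and `S` is assumed because the exponent may have either sign; the
constant is uniform in `|e| ≤ E`. -/
theorem rpow_le_mul_rpow {Q S x e E : ℝ} (hQ : 1 ≤ Q) (hS : 0 < S) (h1 : S ≤ Q * x)
    (h2 : x ≤ Q * S) (he : |e| ≤ E) : x ^ e ≤ Q ^ E * S ^ e := by
  have hx : 0 < x := by
    by_contra! h
    nlinarith
  have hQ0 : 0 < Q := by linarith
  have hm : Q ^ |e| ≤ Q ^ E := Real.rpow_le_rpow_of_exponent_le hQ he
  have hSe : 0 < S ^ e := Real.rpow_pos_of_pos hS e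
  refine le_trans ?_ (mul_le_mul_of_nonneg_right hm hSe.le)
  rcases le_total 0 e with h | h
  · rw [abs_of_nonneg h, ← Real.mul_rpow hQ0.le hS.le]
    exact Real.rpow_le_rpow hx.le h2 h
  · rw [abs_of_nonpos h, Real.rpow_neg hQ0.le, ← div_eq_inv_mul, le_div_iff₀ (by positivity),
      mul_comm, ← Real.mul_rpow hQ0.le hx.le]
    exact Real.rpow_le_rpow_of_nonpos hS h1 h

theorem linForm_pos {u a b : Fin 2 → ℝ} (hu : ∀ i, 0 < u i) (ha : ∀ i, 0 < a i)
    (hb : ∀ i, 0 < b i) (i : Fin 2) {t y : ℝ} (ht : 0 ≤ t) (hy : 0 ≤ y) :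
    0 < linForm u a b i t y := by
  have := hu i
  have := (ha i).le
  have := (hb i).le
  unfold linForm
  positivity

theorem norm_linForm_cpow_le {u a b : Fin 2 → ℝ} (hu : ∀ i, 0 < u i) (ha : ∀ i, 0 < a i)
    (hb : ∀ i, 0 < b i) (i : Fin 2) (B : ℝ) :
    ∃ C, 0 ≤ C ∧ ∀ s : ℂ, ‖s‖ ≤ B → ∀ t y : ℝ, 0 ≤ t → 0 ≤ y →
      ‖(linForm u a b i t y : ℂ) ^ (-s)‖ ≤ C * (1 + t + y) ^ (-s.re) := by
  have h1 := hu i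
  have h2 := ha i
  have h3 := hb i
  -- `Q` dominates the coefficients and their inverses, so the form and `1 + t + y` bound each other
  -- up to the factor `Q`.
  set Q := 1 + u i + a i + b i + (u i)⁻¹ + (a i)⁻¹ + (b i)⁻¹ with hQ
  have i1 : 0 < (u i)⁻¹ := by positivity
  have i2 : 0 < (a i)⁻¹ := by positivity
  have i3 : 0 < (b i)⁻¹ := by positivity
  have hQ1 : 1 ≤ Q := by linarith
  have q1 : 1 ≤ Q * u i := by
    rw [← inv_mul_cancel₀ h1.ne']; gcongr; linarith
  have q2 : 1 ≤ Q * a i := by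
    rw [← inv_mul_cancel₀ h2.ne']; gcongr; linarith
  have q3 : 1 ≤ Q * b i := by
    rw [← inv_mul_cancel₀ h3.ne']; gcongr; linarith
  refine ⟨Q ^ B, by positivity, fun s hs t y ht hy => ?_⟩
  rw [Complex.norm_cpow_eq_rpow_re_of_pos (linForm_pos hu ha hb i ht hy), Complex.neg_re]
  refine rpow_le_mul_rpow hQ1 (by positivity) ?_ ?_ ?_
  · unfold linForm
    nlinarith
  · unfold linForm
    have : u i ≤ Q := by linarith
    have : a i ≤ Q := by linarith
    have : b i ≤ Q := by linarith
    nlinarith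
  · rw [abs_neg]
    exact (Complex.abs_re_le_norm s).trans hs

/-- Separate exponents `s₁`, `s₂` make the kernels closed under differentiation: each derivative
raises one exponent by 1. This drives the induction on the order of the difference. -/
theorem hasDerivAt_kernel {u a b : Fin 2 → ℝ} (hu : ∀ i, 0 < u i) (ha : ∀ i, 0 < a i)
    (hb : ∀ i, 0 < b i) (s₁ s₂ : ℂ) {t y : ℝ} (ht : 0 ≤ t) (hy : 0 ≤ y) :
    HasDerivAt (fun t => kernel u a b s₁ s₂ t y)
      ((-s₁ * a 0) * kernel u a b (s₁ + 1) s₂ t y + (-s₂ * a 1) * kernel u a b s₁ (s₂ + 1) t y)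
      t := by
  have h (i : Fin 2) (s : ℂ) : HasDerivAt (fun t => (linForm u a b i t y : ℂ) ^ (-s))
      (-s * (linForm u a b i t y : ℂ) ^ (-s - 1) * (a i : ℂ)) t := by
    have hl : HasDerivAt (fun t => (linForm u a b i t y : ℂ)) (a i : ℂ) t := by
      refine HasDerivAt.ofReal_comp ?_
      have := (((hasDerivAt_id t).const_mul (a i)).const_add (u i)).add_const (b i * y)
      simpa [linForm] using this
    have hp := linForm_pos hu ha hb i ht hy
    have hc := (hasDerivAt_id (linForm u a b i t y : ℂ)).cpow_const (c := -s)
      (Complex.ofReal_mem_slitPlane.2 hp)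
    exact (hc.comp t hl).congr_deriv (by rw [mul_one, id])
  refine ((h 0 s₁).mul (h 1 s₂)).congr_deriv ?_
  simp only [kernel]
  rw [neg_add', neg_add']
  ring

theorem hasDerivAt_fwdDiff_iter {f f' : ℝ → ℂ} (h : ∀ t, 0 ≤ t → HasDerivAt f (f' t) t) (K : ℕ)
    {t : ℝ} (ht : 0 ≤ t) :
    HasDerivAt ((fwdDiff (1 : ℝ))^[K] f) ((fwdDiff (1 : ℝ))^[K] f' t) t := by
  induction K generalizing t with
  | zero => exact h t ht
  | succ K ih =>
    rw [Function.iterate_succ_apply', Function.iterate_succ_apply']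
    exact ((ih (t := t + 1) (by linarith)).comp_add_const t 1).sub (ih ht)

theorem fwdDiff_iter_linear_combination (f g : ℝ → ℂ) (c d : ℂ) (K : ℕ) (t : ℝ) :
    (fwdDiff (1 : ℝ))^[K] (fun t => c * f t + d * g t) t =
      c * (fwdDiff (1 : ℝ))^[K] f t + d * (fwdDiff (1 : ℝ))^[K] g t := by
  have : (fun t => c * f t + d * g t) = c • f + d • g := rfl
  rw [this, fwdDiff_iter_add, fwdDiff_iter_const_smul, fwdDiff_iter_const_smul]
  rfl

/-- The `K`-th difference of the kernel in one variable gains `K` powers of decay. -/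
theorem norm_fwdDiff_kernel_le {u a b : Fin 2 → ℝ} (hu : ∀ i, 0 < u i) (ha : ∀ i, 0 < a i)
    (hb : ∀ i, 0 < b i) (K : ℕ) (B : ℝ) :
    ∃ C, 0 ≤ C ∧ ∀ s₁ s₂ : ℂ, ‖s₁‖ ≤ B → ‖s₂‖ ≤ B → ∀ t y : ℝ, 0 ≤ t → 0 ≤ y →
      ‖(fwdDiff (1 : ℝ))^[K] (fun t => kernel u a b s₁ s₂ t y) t‖ ≤
        C * (1 + t + y) ^ (-(s₁.re + s₂.re) - K) := by
  induction K generalizing B with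
  | zero =>
    obtain ⟨C₀, hC₀, h₀⟩ := norm_linForm_cpow_le hu ha hb 0 B
    obtain ⟨C₁, hC₁, h₁⟩ := norm_linForm_cpow_le hu ha hb 1 B
    refine ⟨C₀ * C₁, by positivity, fun s₁ s₂ hs₁ hs₂ t y ht hy => ?_⟩
    have hS : 0 < 1 + t + y := by positivity
    have he : -(s₁.re + s₂.re) - ((0 : ℕ) : ℝ) = -s₁.re + -s₂.re := by simp; ring
    rw [Function.iterate_zero_apply, kernel, norm_mul, he, Real.rpow_add hS]
    calc _ ≤ (C₀ * (1 + t + y) ^ (-s₁.re)) * (C₁ * (1 + t + y) ^ (-s₂.re)) := by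
          gcongr
          · exact h₀ s₁ hs₁ t y ht hy
          · exact h₁ s₂ hs₂ t y ht hy
      _ = _ := by ring
  | succ K ih =>
    -- The derivative involves the exponents `s₁ + 1` and `s₂ + 1`, hence the larger bound.
    obtain ⟨C, hC, h⟩ := ih (B + 1)
    rcases lt_or_ge B 0 with hB | hB
    · exact ⟨0, le_rfl, fun s₁ s₂ hs₁ => absurd (norm_nonneg s₁) (by linarith)⟩
    have ha0 := ha 0
    have ha1 := ha 1
    refine ⟨(B * a 0 * C + B * a 1 * C) * 2 ^ (2 * B + K + 1), by positivity,
      fun s₁ s₂ hs₁ hs₂ t y ht hy => ?_⟩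
    set e : ℝ := -(s₁.re + s₂.re) - (K + 1 : ℕ) with he
    have hS : 0 < 1 + t + y := by positivity
    have hE : |e| ≤ 2 * B + K + 1 := by
      have h1 := abs_le.1 ((Complex.abs_re_le_norm s₁).trans hs₁)
      have h2 := abs_le.1 ((Complex.abs_re_le_norm s₂).trans hs₂)
      rw [abs_le, he]
      push_cast
      constructor <;> linarith [h1.1, h1.2, h2.1, h2.2]
    have hs₁' : ‖s₁ + 1‖ ≤ B + 1 := (norm_add_le _ _).trans (by simpa using hs₁)
    have hs₂' : ‖s₂ + 1‖ ≤ B + 1 := (norm_add_le _ _).trans (by simpa using hs₂)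
    have hder (x : ℝ) (hx : x ∈ Set.Icc t (t + 1)) := (hasDerivAt_fwdDiff_iter
      (fun t ht => hasDerivAt_kernel hu ha hb s₁ s₂ ht hy) K
        (ht.trans hx.1)).hasDerivWithinAt (s := Set.Icc t (t + 1))
    have hbd (x : ℝ) (hx : x ∈ Set.Ico t (t + 1)) :
        ‖(fwdDiff (1 : ℝ))^[K] (fun t => (-s₁ * a 0) * kernel u a b (s₁ + 1) s₂ t y +
          (-s₂ * a 1) * kernel u a b s₁ (s₂ + 1) t y) x‖ ≤
        (B * a 0 * C + B * a 1 * C) * 2 ^ (2 * B + K + 1) * (1 + t + y) ^ e := by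
      have hx0 : 0 ≤ x := ht.trans hx.1
      have k1 := h (s₁ + 1) s₂ hs₁' (by linarith) x y hx0 hy
      have k2 := h s₁ (s₂ + 1) (by linarith) hs₂' x y hx0 hy
      have e1 : -((s₁ + 1).re + s₂.re) - (K : ℝ) = e := by rw [he]; simp; ring
      have e2 : -(s₁.re + (s₂ + 1).re) - (K : ℝ) = e := by rw [he]; simp; ring
      rw [e1] at k1
      rw [e2] at k2
      -- As `x` lies within 1 of `t`, the quantities `1 + x + y` and `1 + t + y` agree up to a
      -- factor 2.
      have k3 : (1 + x + y) ^ e ≤ 2 ^ (2 * B + K + 1) * (1 + t + y) ^ e :=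
        rpow_le_mul_rpow one_le_two hS (by linarith [hx.1]) (by linarith [hx.2]) hE
      rw [fwdDiff_iter_linear_combination]
      have n0 : ‖-s₁ * (a 0 : ℂ)‖ ≤ B * a 0 := by
        rw [norm_mul, norm_neg, Complex.norm_real, Real.norm_of_nonneg ha0.le]
        gcongr
      have n1 : ‖-s₂ * (a 1 : ℂ)‖ ≤ B * a 1 := by
        rw [norm_mul, norm_neg, Complex.norm_real, Real.norm_of_nonneg ha1.le]
        gcongr
      calc _ ≤ B * a 0 * (C * (1 + x + y) ^ e) + B * a 1 * (C * (1 + x + y) ^ e) := by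
            refine (norm_add_le _ _).trans (add_le_add ?_ ?_)
            · exact norm_mul_le_of_le n0 k1
            · exact norm_mul_le_of_le n1 k2
        _ = (B * a 0 * C + B * a 1 * C) * (1 + x + y) ^ e := by ring
        _ ≤ (B * a 0 * C + B * a 1 * C) * (2 ^ (2 * B + K + 1) * (1 + t + y) ^ e) := by gcongr
        _ = _ := by ring
    have := norm_image_sub_le_of_norm_deriv_le_segment' hder hbd (t + 1) (by simp)
    rw [Function.iterate_succ_apply', fwdDiff]
    simpa using this

end Decay

/-! ### Abel summation in one variable -/

section AbelSummation

theorem summable_fwdDiff_iter {f : ℝ → ℂ} (hf : Summable fun m : ℕ => f m) (K : ℕ) :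
    Summable fun m : ℕ => (fwdDiff (1 : ℝ))^[K] f m := by
  induction K with
  | zero => exact hf
  | succ K ih =>
    simp only [Function.iterate_succ_apply']
    have := ((summable_nat_add_iff 1).2 ih).sub ih
    simpa [fwdDiff] using this

theorem summable_pow_mul {f : ℕ → ℂ} (hf : Summable f) {z : ℂ} (hz : ‖z‖ ≤ 1) :
    Summable fun m : ℕ => z ^ m * f m := by
  refine Summable.of_norm_bounded hf.norm fun m => ?_
  rw [norm_mul, norm_pow]
  exact mul_le_of_le_one_left (norm_nonneg _) (pow_le_one₀ (norm_nonneg _) hz)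

/-- Split off the term `m = 0`, reindex the rest, and solve the resulting linear equation for the
sum, which is possible as `z ≠ 1`. -/
theorem tsum_pow_mul_eq_step {f : ℝ → ℂ} (hf : Summable fun m : ℕ => f m) {z : ℂ} (hz : ‖z‖ ≤ 1)
    (hz1 : z ≠ 1) :
    ∑' m : ℕ, z ^ m * f m =
      f 0 / (1 - z) + z / (1 - z) * ∑' m : ℕ, z ^ m * fwdDiff (1 : ℝ) f m := by
  have hz' : 1 - z ≠ 0 := sub_ne_zero.2 hz1.symm
  have hs := summable_pow_mul hf hz
  have hs1 := summable_pow_mul ((summable_nat_add_iff 1).2 hf) hz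
  have h1 := hs.tsum_eq_zero_add
  have h2 : ∑' m : ℕ, z ^ m * fwdDiff (1 : ℝ) f m =
      ∑' m : ℕ, z ^ m * f (m + 1 : ℕ) - ∑' m : ℕ, z ^ m * f m := by
    rw [← hs1.tsum_sub hs]
    refine tsum_congr fun m => ?_
    rw [fwdDiff, mul_sub]
    push_cast
    rfl
  have h3 : ∑' m : ℕ, z ^ (m + 1) * f (m + 1 : ℕ) = z * ∑' m : ℕ, z ^ m * f (m + 1 : ℕ) := by
    rw [← tsum_mul_left]
    exact tsum_congr fun m => by ring
  rw [h3] at h1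
  simp only [pow_zero, Nat.cast_zero, one_mul] at h1
  rw [h2]
  field_simp
  linear_combination h1

/-- Repeated Abel summation of `∑ z ^ m f(m)`. -/
theorem tsum_pow_mul_eq {f : ℝ → ℂ} (hf : Summable fun m : ℕ => f m) {z : ℂ} (hz : ‖z‖ ≤ 1)
    (hz1 : z ≠ 1) (K : ℕ) :
    ∑' m : ℕ, z ^ m * f m =
      ∑ j ∈ range K, abelCoeff z j * (fwdDiff (1 : ℝ))^[j] f 0 +
        (z / (1 - z)) ^ K * ∑' m : ℕ, z ^ m * (fwdDiff (1 : ℝ))^[K] f m := by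
  induction K with
  | zero => simp
  | succ K ih =>
    rw [ih, tsum_pow_mul_eq_step (summable_fwdDiff_iter hf K) hz hz1, sum_range_succ]
    simp only [Function.iterate_succ_apply', abelCoeff]
    ring

end AbelSummation

/-! ### Continuation of the double series and its values at non-positive integers -/

section Continuation

/-- The difference of order `j` in the first variable at `0` and order `l` in the second one. -/
def mixedDiff (k : ℝ → ℝ → ℂ) (j l : ℕ) (y : ℝ) : ℂ :=
  (fwdDiff (1 : ℝ))^[l] (fun y => (fwdDiff (1 : ℝ))^[j] (fun t => k t y) 0) y

/-- Only the `t`-difference is expanded; the `y`-difference is kept intact because the decay comes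
from it. -/
theorem mixedDiff_eq_sum (k : ℝ → ℝ → ℂ) (j l : ℕ) (y : ℝ) :
    mixedDiff k j l y = ∑ i ∈ range (j + 1), (((-1 : ℤ) ^ (j - i) * j.choose i : ℤ) : ℂ) *
      (fwdDiff (1 : ℝ))^[l] (fun y => k i y) y := by
  have : (fun y => (fwdDiff (1 : ℝ))^[j] (fun t => k t y) 0) =
      ∑ i ∈ range (j + 1), ((-1 : ℤ) ^ (j - i) * j.choose i : ℤ) • fun y => k i y := by
    ext y
    simp [fwdDiff_iter_eq_sum_shift]
  rw [mixedDiff, this, fwdDiff_iter_finsetSum, Finset.sum_apply]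
  refine sum_congr rfl fun i _ => ?_
  rw [fwdDiff_iter_const_smul, Pi.smul_apply, zsmul_eq_mul]

/-- Absorbing `t` into the base point and exchanging the variables makes the estimates for
`t`-differences available for `y`-differences. -/
theorem kernel_eq_kernel_add (u a b : Fin 2 → ℝ) (s₁ s₂ : ℂ) (t y : ℝ) :
    kernel u a b s₁ s₂ t y = kernel (fun i => u i + a i * t) b a s₁ s₂ y 0 := by
  simp [kernel, linForm]

theorem differentiable_kernel {u a b : Fin 2 → ℝ} (hu : ∀ i, 0 < u i) (ha : ∀ i, 0 < a i)
    (hb : ∀ i, 0 < b i) {t y : ℝ} (ht : 0 ≤ t) (hy : 0 ≤ y) :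
    Differentiable ℂ fun s => kernel u a b s s t y := by
  have h (i : Fin 2) : Differentiable ℂ fun s : ℂ => (linForm u a b i t y : ℂ) ^ (-s) :=
    (differentiable_id.neg).const_cpow
      (Or.inl (by exact_mod_cast (linForm_pos hu ha hb i ht hy).ne'))
  exact (h 0).mul (h 1)

theorem differentiable_fwdDiff_kernel {u a b : Fin 2 → ℝ} (hu : ∀ i, 0 < u i)
    (ha : ∀ i, 0 < a i) (hb : ∀ i, 0 < b i) (K : ℕ) {t y : ℝ} (ht : 0 ≤ t) (hy : 0 ≤ y) :
    Differentiable ℂ fun s => (fwdDiff (1 : ℝ))^[K] (fun t => kernel u a b s s t y) t := by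
  simp only [fwdDiff_iter_eq_sum_shift, zsmul_eq_mul]
  refine Differentiable.fun_sum fun i _ => (differentiable_const _).mul ?_
  exact differentiable_kernel hu ha hb (by simp; positivity) hy

theorem add_mul_natCast_pos {u a : Fin 2 → ℝ} (hu : ∀ i, 0 < u i) (ha : ∀ i, 0 < a i) (m : ℕ)
    (i : Fin 2) : 0 < u i + a i * m := by
  have := hu i
  have := ha i
  positivity

theorem differentiable_mixedDiff_kernel {u a b : Fin 2 → ℝ} (hu : ∀ i, 0 < u i)
    (ha : ∀ i, 0 < a i) (hb : ∀ i, 0 < b i) (j l : ℕ) {y : ℝ} (hy : 0 ≤ y) :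
    Differentiable ℂ fun s => mixedDiff (kernel u a b s s) j l y := by
  simp only [mixedDiff_eq_sum, kernel_eq_kernel_add u]
  exact Differentiable.fun_sum fun i _ => (differentiable_const _).mul
    (differentiable_fwdDiff_kernel (add_mul_natCast_pos hu ha i) hb ha l hy le_rfl)

theorem norm_mixedDiff_kernel_le {u a b : Fin 2 → ℝ} (hu : ∀ i, 0 < u i)
    (ha : ∀ i, 0 < a i) (hb : ∀ i, 0 < b i) (j K : ℕ) (B : ℝ) :
    ∃ C, 0 ≤ C ∧ ∀ s : ℂ, ‖s‖ ≤ B → ∀ y : ℝ, 0 ≤ y →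
      ‖mixedDiff (kernel u a b s s) j K y‖ ≤ C * (1 + y) ^ (-2 * s.re - K) := by
  choose C hC h using fun i : ℕ =>
    norm_fwdDiff_kernel_le (add_mul_natCast_pos hu ha i) hb ha K B
  refine ⟨∑ i ∈ range (j + 1), ‖(((-1 : ℤ) ^ (j - i) * j.choose i : ℤ) : ℂ)‖ * C i,
    sum_nonneg fun i _ => mul_nonneg (norm_nonneg _) (hC i), fun s hs y hy => ?_⟩
  simp only [mixedDiff_eq_sum, kernel_eq_kernel_add u]
  rw [sum_mul]
  refine norm_sum_le_of_le _ fun i _ => ?_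
  rw [norm_mul, mul_assoc]
  gcongr
  have := h i s s hs hs y 0 hy le_rfl
  rw [add_zero] at this
  rwa [show -(s.re + s.re) - (K : ℝ) = -2 * s.re - K by ring] at this

/-- Weierstrass' theorem: near `s₀`, a ball fixes the constant `C`, and an `e` strictly between `d`
and `2 Re s₀ + K` gives the single summable majorant `C w^(-e)`. -/
theorem differentiableOn_tsum_of_decay {α : Type*} {F : α → ℂ → ℂ} {w : α → ℝ} {d K : ℝ}
    (hw : ∀ i, 1 ≤ w i) (hsum : ∀ e, d < e → Summable fun i => w i ^ (-e))
    (hF : ∀ i, Differentiable ℂ (F i))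
    (hbd : ∀ B : ℝ, ∃ C, 0 ≤ C ∧ ∀ s : ℂ, ‖s‖ ≤ B → ∀ i, ‖F i s‖ ≤ C * w i ^ (-2 * s.re - K)) :
    DifferentiableOn ℂ (fun s => ∑' i, F i s) {s | d < 2 * s.re + K} := by
  intro s₀ hs₀
  rw [Set.mem_ofPred_eq] at hs₀
  obtain ⟨C, hC, hb⟩ := hbd (‖s₀‖ + 1)
  obtain ⟨e, hde, hes⟩ := exists_between hs₀
  set U : Set ℂ := Metric.ball 0 (‖s₀‖ + 1) ∩ {s | e < 2 * s.re + K} with hU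
  have hUo : IsOpen U := Metric.isOpen_ball.inter
    (isOpen_lt continuous_const ((continuous_const.mul Complex.continuous_re).add_const K))
  have hmem : s₀ ∈ U := ⟨by simp, hes⟩
  have hd := Complex.differentiableOn_tsum_of_summable_norm ((hsum e hde).mul_left C)
    (fun i => (hF i).differentiableOn) hUo (fun i s hs => by
      refine (hb s (by simpa using (Metric.mem_ball.1 hs.1).le) i).trans ?_
      have := hs.2
      rw [Set.mem_ofPred_eq] at this
      gcongr
      · exact hw i
      · linarith)
  exact (hd.differentiableAt (hUo.mem_nhds hmem)).differentiableWithinAt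

theorem summable_one_add_rpow {e : ℝ} (he : 1 < e) : Summable fun m : ℕ => (1 + m : ℝ) ^ (-e) := by
  have := (summable_nat_add_iff 1).2 (Real.summable_nat_rpow.2 (neg_lt_neg he))
  simpa [add_comm] using this

/-- From `(1 + m + n)² ≥ (1 + m)(1 + n)` the series is dominated by a product of two convergent ones
with exponent `e / 2`. -/
theorem summable_one_add_add_rpow {e : ℝ} (he : 2 < e) :
    Summable fun m : ℕ × ℕ => (1 + m.1 + m.2 : ℝ) ^ (-e) := by
  have h := summable_one_add_rpow (e := e / 2) (by linarith)
  refine Summable.of_nonneg_of_le (fun m => by positivity) (fun m => ?_)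
    (h.mul_of_nonneg h (fun m => by positivity) (fun m => by positivity))
  have e1 : ((1 + m.1 + m.2 : ℝ)) ^ (-e) = ((1 + m.1 + m.2) ^ 2) ^ (-(e / 2)) := by
    rw [← Real.rpow_natCast, ← Real.rpow_mul (by positivity)]
    congr 1
    push_cast
    ring
  rw [e1, ← Real.mul_rpow (by positivity) (by positivity)]
  refine Real.rpow_le_rpow_of_nonpos (by positivity) ?_ (by linarith)
  have : (0 : ℝ) ≤ m.1 := by positivity
  have : (0 : ℝ) ≤ m.2 := by positivity
  nlinarith

theorem summable_kernel {u a b : Fin 2 → ℝ} (hu : ∀ i, 0 < u i) (ha : ∀ i, 0 < a i)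
    (hb : ∀ i, 0 < b i) {s : ℂ} (hs : 1 < s.re) :
    Summable fun m : ℕ × ℕ => kernel u a b s s m.1 m.2 := by
  obtain ⟨C, hC, h⟩ := norm_fwdDiff_kernel_le hu ha hb 0 ‖s‖
  refine Summable.of_norm_bounded
    ((summable_one_add_add_rpow (e := s.re + s.re) (by linarith)).mul_left C) fun m => ?_
  simpa using h s s le_rfl le_rfl m.1 m.2 (by positivity) (by positivity)

/-- The Dirichlet series `∑ z ^ m w ^ n (L₀(m, n) L₁(m, n)) ^ (-s)`. -/
def coneSum (u a b : Fin 2 → ℝ) (z w s : ℂ) : ℂ :=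
  ∑' m : ℕ × ℕ, z ^ m.1 * w ^ m.2 * kernel u a b s s m.1 m.2

/-- The expression for `coneSum` obtained from Abel summation of order `K` in both variables. -/
def abelConeSum (u a b : Fin 2 → ℝ) (z w : ℂ) (K : ℕ) (s : ℂ) : ℂ :=
  ∑ j ∈ range K, abelCoeff z j *
    (∑ l ∈ range K, abelCoeff w l * mixedDiff (kernel u a b s s) j l 0 +
      (w / (1 - w)) ^ K * ∑' m : ℕ, w ^ m * mixedDiff (kernel u a b s s) j K m) +
  (z / (1 - z)) ^ K * ∑' m : ℕ × ℕ, z ^ m.1 * w ^ m.2 *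
    (fwdDiff (1 : ℝ))^[K] (fun t => kernel u a b s s t m.2) m.1

theorem differentiableOn_abelConeSum {u a b : Fin 2 → ℝ} (hu : ∀ i, 0 < u i)
    (ha : ∀ i, 0 < a i) (hb : ∀ i, 0 < b i) {z w : ℂ} (hz : ‖z‖ ≤ 1) (hw : ‖w‖ ≤ 1) (K : ℕ) :
    DifferentiableOn ℂ (abelConeSum u a b z w K) {s | 2 < 2 * s.re + K} := by
  refine DifferentiableOn.add (DifferentiableOn.fun_sum fun j _ =>
    (DifferentiableOn.add (DifferentiableOn.fun_sum fun l _ => ?_) ?_).const_mul _) ?_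
  · exact ((differentiable_mixedDiff_kernel hu ha hb j l le_rfl).const_mul _).differentiableOn
  · refine DifferentiableOn.const_mul ?_ _
    refine differentiableOn_tsum_of_decay (w := fun m : ℕ => 1 + m) (fun m => by simp)
      (fun e he => summable_one_add_rpow (by linarith)) (fun m =>
        (differentiable_mixedDiff_kernel hu ha hb j K (by positivity)).const_mul _) fun B => ?_
    obtain ⟨C, hC, h⟩ := norm_mixedDiff_kernel_le hu ha hb j K B
    refine ⟨C, hC, fun s hs m => le_trans ?_ (h s hs m (by positivity))⟩
    rw [norm_mul, norm_pow]
    exact mul_le_of_le_one_left (norm_nonneg _) (pow_le_one₀ (norm_nonneg _) hw)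
  · refine DifferentiableOn.const_mul ?_ _
    refine differentiableOn_tsum_of_decay (w := fun m : ℕ × ℕ => 1 + m.1 + m.2)
      (fun m => by rw [add_assoc]; simp; positivity)
      (fun e he => summable_one_add_add_rpow he) (fun m =>
        (differentiable_fwdDiff_kernel hu ha hb K (by positivity) (by positivity)).const_mul _)
      fun B => ?_
    obtain ⟨C, hC, h⟩ := norm_fwdDiff_kernel_le hu ha hb K B
    refine ⟨C, hC, fun s hs m => ?_⟩
    have h1 := h s s hs hs m.1 m.2 (by positivity) (by positivity)
    rw [show -(s.re + s.re) - (K : ℝ) = -2 * s.re - K by ring] at h1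
    refine le_trans ?_ h1
    rw [norm_mul, norm_mul, norm_pow, norm_pow]
    exact mul_le_of_le_one_left (norm_nonneg _) (mul_le_one₀ (pow_le_one₀ (norm_nonneg _) hz)
      (by positivity) (pow_le_one₀ (norm_nonneg _) hw))

theorem summable_prod_pow_mul {f : ℕ × ℕ → ℂ} (hf : Summable f) {z w : ℂ} (hz : ‖z‖ ≤ 1)
    (hw : ‖w‖ ≤ 1) : Summable fun m : ℕ × ℕ => w ^ m.1 * (z ^ m.2 * f (m.2, m.1)) := by
  have hf' : Summable fun m : ℕ × ℕ => f (m.2, m.1) := (Equiv.prodComm ℕ ℕ).summable_iff.2 hf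
  refine Summable.of_norm_bounded hf'.norm fun m => ?_
  rw [← mul_assoc, norm_mul, norm_mul, norm_pow, norm_pow]
  exact mul_le_of_le_one_left (norm_nonneg _) (mul_le_one₀ (pow_le_one₀ (norm_nonneg _) hw)
    (by positivity) (pow_le_one₀ (norm_nonneg _) hz))

theorem summable_pow_mul_tsum {f : ℕ × ℕ → ℂ} (hf : Summable f) {z w : ℂ} (hz : ‖z‖ ≤ 1)
    (hw : ‖w‖ ≤ 1) : Summable fun n : ℕ => w ^ n * ∑' m : ℕ, z ^ m * f (m, n) := by
  simpa only [tsum_mul_left] using (summable_prod_pow_mul hf hz hw).prod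

theorem tsum_prod_pow_mul {f : ℕ × ℕ → ℂ} (hf : Summable f) {z w : ℂ} (hz : ‖z‖ ≤ 1)
    (hw : ‖w‖ ≤ 1) : ∑' m : ℕ × ℕ, z ^ m.1 * w ^ m.2 * f m =
      ∑' n : ℕ, w ^ n * ∑' m : ℕ, z ^ m * f (m, n) := by
  rw [← (Equiv.prodComm ℕ ℕ).tsum_eq]
  simp only [Equiv.prodComm_apply, Prod.swap]
  have h : ∀ m : ℕ × ℕ, z ^ m.2 * w ^ m.1 * f (m.2, m.1) = w ^ m.1 * (z ^ m.2 * f (m.2, m.1)) :=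
    fun m => by ring
  simp only [h, (summable_prod_pow_mul hf hz hw).tsum_prod, tsum_mul_left]

/-- Abel summation in both variables of a double series. -/
theorem tsum_prod_pow_mul_eq {k : ℝ → ℝ → ℂ} (hk : Summable fun m : ℕ × ℕ => k m.1 m.2) {z w : ℂ}
    (hz : ‖z‖ ≤ 1) (hz1 : z ≠ 1) (hw : ‖w‖ ≤ 1) (hw1 : w ≠ 1) (K : ℕ) :
    ∑' m : ℕ × ℕ, z ^ m.1 * w ^ m.2 * k m.1 m.2 =
      ∑ j ∈ range K, abelCoeff z j * (∑ l ∈ range K, abelCoeff w l * mixedDiff k j l 0 +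
        (w / (1 - w)) ^ K * ∑' m : ℕ, w ^ m * mixedDiff k j K m) +
      (z / (1 - z)) ^ K * ∑' m : ℕ × ℕ, z ^ m.1 * w ^ m.2 *
        (fwdDiff (1 : ℝ))^[K] (fun t => k t m.2) m.1 := by
  have hD (K : ℕ) : Summable fun m : ℕ × ℕ => (fwdDiff (1 : ℝ))^[K] (fun t => k t m.2) m.1 := by
    simp only [fwdDiff_iter_eq_sum_shift]
    refine summable_sum fun i _ => Summable.const_smul _ ?_
    have hinj : Function.Injective fun m : ℕ × ℕ => (m.1 + i, m.2) := by
      rintro ⟨m, n⟩ ⟨m', n'⟩ h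
      simpa using h
    have := hk.comp_injective hinj
    simpa [Function.comp_def] using this
  have hrow (n : ℕ) : Summable fun m : ℕ => k m n :=
    hk.comp_injective (i := fun m : ℕ => (m, n)) fun m m' h => by simpa using h
  have hcol (j : ℕ) : Summable fun n : ℕ =>
      (fun y => (fwdDiff (1 : ℝ))^[j] (fun t => k t y) 0) (n : ℝ) := by
    have := (hD j).comp_injective (i := fun n : ℕ => (0, n)) fun m m' h => by simpa using h
    simpa [Function.comp_def] using this
  -- Sum by parts in `m` for fixed `n`. Only the boundary terms are then summed by parts in `n`; the
  -- `K`-th `t`-difference of the kernel already decays in both variables.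
  have hrw (n : ℕ) : w ^ n * ∑' m : ℕ, z ^ m * k m n =
      ∑ j ∈ range K, abelCoeff z j * (w ^ n * (fwdDiff (1 : ℝ))^[j] (fun t => k t n) 0) +
      (z / (1 - z)) ^ K * (w ^ n *
        ∑' m : ℕ, z ^ m * (fwdDiff (1 : ℝ))^[K] (fun t => k t n) m) := by
    rw [tsum_pow_mul_eq (f := fun t => k t n) (hrow n) hz hz1 K, mul_add, mul_sum]
    congr 1
    · exact sum_congr rfl fun j _ => by ring
    · ring
  have hs (j : ℕ) : Summable fun n : ℕ =>
      abelCoeff z j * (w ^ n * (fwdDiff (1 : ℝ))^[j] (fun t => k t n) 0) :=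
    (summable_pow_mul (hcol j) hw).mul_left _
  have hcoleq (j : ℕ) :
      ∑' n : ℕ, abelCoeff z j * (w ^ n * (fwdDiff (1 : ℝ))^[j] (fun t => k t n) 0) =
      abelCoeff z j * (∑ l ∈ range K, abelCoeff w l * mixedDiff k j l 0 +
        (w / (1 - w)) ^ K * ∑' m : ℕ, w ^ m * mixedDiff k j K m) := by
    rw [tsum_mul_left]
    exact congrArg _ (tsum_pow_mul_eq
      (f := fun y => (fwdDiff (1 : ℝ))^[j] (fun t => k t y) 0) (hcol j) hw hw1 K)
  have hsum : Summable fun n : ℕ => (z / (1 - z)) ^ K * (w ^ n *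
      ∑' m : ℕ, z ^ m * (fwdDiff (1 : ℝ))^[K] (fun t => k t n) m) :=
    (summable_pow_mul_tsum (hD K) hz hw).mul_left _
  calc _ = ∑' n : ℕ, w ^ n * ∑' m : ℕ, z ^ m * k m n := tsum_prod_pow_mul hk hz hw
    _ = _ := tsum_congr hrw
    _ = _ := Summable.tsum_add (summable_sum fun j _ => hs j) hsum
    _ = _ := congrArg₂ (· + ·) ((Summable.tsum_finsetSum fun j _ => hs j).trans
        (sum_congr rfl fun j _ => hcoleq j))
      (tsum_mul_left.trans (congrArg _ (tsum_prod_pow_mul (hD K) hz hw).symm))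

theorem coneSum_eq_abelConeSum {u a b : Fin 2 → ℝ} (hu : ∀ i, 0 < u i)
    (ha : ∀ i, 0 < a i) (hb : ∀ i, 0 < b i) {z w : ℂ} (hz : ‖z‖ ≤ 1) (hz1 : z ≠ 1)
    (hw : ‖w‖ ≤ 1) (hw1 : w ≠ 1) (K : ℕ) {s : ℂ} (hs : 1 < s.re) :
    coneSum u a b z w s = abelConeSum u a b z w K s :=
  tsum_prod_pow_mul_eq (summable_kernel hu ha hb hs) hz hz1 hw hw1 K

/-- Functions holomorphic on half planes exhausting `ℂ` which agree for `Re s > 1` glue to an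
entire function. -/
theorem exists_differentiable_of_halfPlanes {E : ℕ → ℂ → ℂ}
    (hE : ∀ K, DifferentiableOn ℂ (E K) {s | 2 < 2 * s.re + K})
    (heq : ∀ K s, 1 < s.re → E K s = E 0 s) :
    ∃ Z : ℂ → ℂ, Differentiable ℂ Z ∧ ∀ (K : ℕ) (s : ℂ), 2 < 2 * s.re + K → Z s = E K s := by
  have hopen (K : ℕ) : IsOpen {s : ℂ | 2 < 2 * s.re + K} :=
    isOpen_lt continuous_const ((continuous_const.mul Complex.continuous_re).add_const _)
  have hcompat {K L : ℕ} (hKL : K ≤ L) : Set.EqOn (E K) (E L) {s | 2 < 2 * s.re + K} := by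
    have hsub : {s : ℂ | 2 < 2 * s.re + K} ⊆ {s | 2 < 2 * s.re + L} := fun s hs => by
      have : (K : ℝ) ≤ L := by exact_mod_cast hKL
      simp only [Set.mem_ofPred_eq] at hs ⊢
      linarith
    -- Identity theorem based at 2, a point of every half plane at which `Re s > 1`.
    refine AnalyticOnNhd.eqOn_of_preconnected_of_eventuallyEq (z₀ := 2)
      ((hE K).analyticOnNhd (hopen K))
      (((hE L).mono hsub).analyticOnNhd (hopen K)) ?_ ?_ ?_
    · have : {s : ℂ | 2 < 2 * s.re + K} = {s : ℂ | (2 - K) / 2 < s.re} := by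
        ext s
        simp only [Set.mem_ofPred_eq, div_lt_iff₀ (zero_lt_two' ℝ)]
        constructor <;> intro h <;> linarith
      rw [this]
      exact (convex_halfSpace_re_gt _).isPreconnected
    · have : (0 : ℝ) ≤ K := by positivity
      simp only [Set.mem_ofPred_eq, Complex.re_ofNat]
      linarith
    · filter_upwards [(isOpen_lt continuous_const Complex.continuous_re).mem_nhds
        (show (2 : ℂ) ∈ {s : ℂ | 1 < s.re} by simp)] with s hs
      rw [heq K s hs, heq L s hs]
  choose N hN using fun s : ℂ => exists_nat_gt (2 - 2 * s.re)
  have hZ (K : ℕ) (s : ℂ) (hs : 2 < 2 * s.re + K) : E (N s) s = E K s := by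
    have h1 : 2 < 2 * s.re + N s := by linarith [hN s]
    rcases le_total (N s) K with h | h
    · exact hcompat h h1
    · exact (hcompat h hs).symm
  refine ⟨fun s => E (N s) s, fun s => ?_, hZ⟩
  have hmem : {x : ℂ | 2 < 2 * x.re + N s} ∈ nhds s :=
    (hopen (N s)).mem_nhds (by simp only [Set.mem_ofPred_eq]; linarith [hN s])
  exact ((hE (N s)).differentiableAt hmem).congr_of_eventuallyEq
    (Filter.mem_of_superset hmem fun x hx => hZ (N s) x hx)

theorem kernel_neg_natCast (u a b : Fin 2 → ℝ) (n : ℕ) (t y : ℝ) :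
    kernel u a b (-n) (-n) t y = normFormPow u a b n t y := by
  simp [kernel, normFormPow, linForm, mul_pow]

theorem fwdDiff_iter_ofReal_comp (f : ℝ → ℝ) (K : ℕ) (t : ℝ) :
    (fwdDiff (1 : ℝ))^[K] (fun t => (f t : ℂ)) t = ((fwdDiff (1 : ℝ))^[K] f t : ℝ) := by
  simp [fwdDiff_iter_eq_sum_shift]

/-- For fixed `y` this is a polynomial in `t` of degree at most `2n`, so differences of higher order
vanish. -/
theorem fwdDiff_normFormPow_eq_zero (u a b : Fin 2 → ℝ) {n K : ℕ} (hK : 2 * n < K) (t y : ℝ) :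
    (fwdDiff (1 : ℝ))^[K] (fun t => normFormPow u a b n t y) t = 0 := by
  open Polynomial in
  set P : ℝ[X] := ((C (u 0 + b 0 * y) + C (a 0) * X) * (C (u 1 + b 1 * y) + C (a 1) * X)) ^ n
    with hP
  have hdeg : P.natDegree < K := by
    refine lt_of_le_of_lt ?_ hK
    rw [mul_comm, hP]
    compute_degree
  have h : (fun t => normFormPow u a b n t y) = fun t => ((P.eval t : ℝ) : ℂ) := by
    ext t
    simp only [normFormPow, hP, Polynomial.eval_pow, Polynomial.eval_mul, Polynomial.eval_add,
      Polynomial.eval_C, Polynomial.eval_X, Complex.ofReal_pow]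
    congr 2
    ring
  rw [h, fwdDiff_iter_ofReal_comp, Polynomial.fwdDiff_iter_eq_zero_of_degree_lt hdeg]
  simp

theorem abelConeSum_neg_natCast (u a b : Fin 2 → ℝ) (z w : ℂ) {n K : ℕ} (hK : 2 * n < K) :
    abelConeSum u a b z w K (-n) = ∑ j ∈ range K, ∑ l ∈ range K, abelCoeff z j * abelCoeff w l *
      mixedDiff (normFormPow u a b n) j l 0 := by
  have hk : kernel u a b (-n) (-n) = normFormPow u a b n := by
    ext t y
    exact kernel_neg_natCast ..
  have hm (j : ℕ) (y : ℝ) : mixedDiff (normFormPow u a b n) j K y = 0 := by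
    rw [mixedDiff_eq_sum]
    refine sum_eq_zero fun i _ => ?_
    have : (fun y => normFormPow u a b n i y) =
        fun y => normFormPow (fun k => u k + a k * i) b a n y 0 := by
      ext y
      simp [normFormPow]
    rw [this, fwdDiff_normFormPow_eq_zero _ _ _ hK, mul_zero]
  simp only [abelConeSum, hk, hm, fwdDiff_normFormPow_eq_zero _ _ _ hK]
  simp [mul_sum, mul_assoc]

/-- The series `coneSum` continues to an entire function, whose values at the non-positive integers
are given by Abel summation. -/
theorem exists_entire_coneSum {u a b : Fin 2 → ℝ} (hu : ∀ i, 0 < u i)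
    (ha : ∀ i, 0 < a i) (hb : ∀ i, 0 < b i) {z w : ℂ} (hz : ‖z‖ ≤ 1) (hz1 : z ≠ 1)
    (hw : ‖w‖ ≤ 1) (hw1 : w ≠ 1) :
    ∃ Z : ℂ → ℂ, Differentiable ℂ Z ∧ (∀ s : ℂ, 1 < s.re → Z s = coneSum u a b z w s) ∧
      ∀ n K : ℕ, 2 * n + 2 < K → Z (-n) = ∑ j ∈ range K, ∑ l ∈ range K,
        abelCoeff z j * abelCoeff w l * mixedDiff (normFormPow u a b n) j l 0 := by
  have h := fun K (s : ℂ) hs => coneSum_eq_abelConeSum hu ha hb hz hz1 hw hw1 K (s := s) hs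
  obtain ⟨Z, hZ, hZE⟩ := exists_differentiable_of_halfPlanes
    (fun K => differentiableOn_abelConeSum hu ha hb hz hw K)
    (fun K s hs => (h K s hs).symm.trans (h 0 s hs))
  refine ⟨Z, hZ, fun s hs => ?_, fun n K hK => ?_⟩
  · rw [hZE 0 s (by simp; linarith), h 0 s hs]
  -- `2n < K` kills the remainders; the stronger `2n + 2 < K` places `-n` in the half plane of
  -- holomorphy.
  · rw [hZE K, abelConeSum_neg_natCast u a b z w (by omega)]
    have : (2 * n + 2 : ℝ) < K := by exact_mod_cast hK
    simp
    linarith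

end Continuation

/-! ### The index condition modulo `p` -/

section Index

variable {k : Type*} [Field k] [NumberField k]

variable {M : Submodule (𝓞 k) k} [Module.Finite (𝓞 k) M]

/-- Each `m / a` is algebraic, so a non-zero integer multiple of it is integral: the quotient is a
finitely generated torsion group. -/
theorem finite_quotient_span_singleton {a : M} (ha : a ≠ 0) :
    Finite (M ⧸ Submodule.span (𝓞 k) {a}) := by
  have : Module.Finite ℤ M := Module.Finite.trans (𝓞 k) M
  have : Module.Finite ℤ (M ⧸ Submodule.span (𝓞 k) {a}) :=
    Module.Finite.trans (𝓞 k) (M ⧸ Submodule.span (𝓞 k) {a})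
  refine Module.finite_of_fg_torsion _ fun x => ?_
  obtain ⟨m, rfl⟩ := Submodule.Quotient.mk_surjective _ x
  have ha' : (a : k) ≠ 0 := by simpa using ha
  have halg : IsAlgebraic ℤ ((m : k) / a) :=
    (IsFractionRing.isAlgebraic_iff ℤ ℚ k).2 (Algebra.IsAlgebraic.isAlgebraic _)
  obtain ⟨y, hy, hint⟩ := halg.exists_integral_multiple
  refine ⟨⟨y, mem_nonZeroDivisors_of_ne_zero hy⟩, ?_⟩
  change y • Submodule.Quotient.mk (p := Submodule.span (𝓞 k) {a}) m = 0
  rw [← Submodule.Quotient.mk_smul, Submodule.Quotient.mk_eq_zero, Submodule.mem_span_singleton]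
  refine ⟨⟨_, hint⟩, Subtype.ext ?_⟩
  change y • ((m : k) / a) * a = y • (m : k)
  rw [smul_mul_assoc, div_mul_cancel₀ _ ha']

/-- For `a ≠ 0` the index `|M : (a)|` is prime to `p` exactly when `(a) + p M = M`. -/
theorem not_dvd_idealIndex_iff {p : ℕ} (hp : p.Prime) {a : M} (ha : a ≠ 0) :
    ¬ p ∣ idealIndex M a ↔ ∀ x : M, ∃ (c : 𝓞 k) (y : M), x = c • a + p • y := by
  have hfin := finite_quotient_span_singleton ha
  have hcard : idealIndex M a = Nat.card (M ⧸ Submodule.span (𝓞 k) {a}) := rfl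
  rw [hcard]
  constructor
  · intro h x
    have hcop : (Nat.card (M ⧸ Submodule.span (𝓞 k) {a})).Coprime p :=
      ((Nat.Prime.coprime_iff_not_dvd hp).2 h).symm
    obtain ⟨q, hq⟩ := (hcop.nsmul_right_bijective).2 (Submodule.Quotient.mk x)
    obtain ⟨y, rfl⟩ := Submodule.Quotient.mk_surjective _ q
    dsimp only at hq
    rw [← Submodule.Quotient.mk_smul, eq_comm, Submodule.Quotient.eq,
      Submodule.mem_span_singleton] at hq
    obtain ⟨c, hc⟩ := hq
    exact ⟨c, y, by rw [hc]; abel⟩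
  · intro h hdvd
    have : Fact p.Prime := ⟨hp⟩
    -- Cauchy gives an element of order `p`, but multiplication by `p` is onto and hence injective
    -- on the finite quotient.
    obtain ⟨q, hq⟩ := exists_prime_addOrderOf_dvd_card' (G := M ⧸ Submodule.span (𝓞 k) {a}) p hdvd
    have hsurj : Function.Surjective fun q : M ⧸ Submodule.span (𝓞 k) {a} => p • q := by
      intro r
      obtain ⟨x, rfl⟩ := Submodule.Quotient.mk_surjective _ r
      obtain ⟨c, y, rfl⟩ := h x
      refine ⟨Submodule.Quotient.mk y, ?_⟩
      dsimp only
      rw [← Submodule.Quotient.mk_smul, eq_comm, Submodule.Quotient.eq, add_sub_cancel_right]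
      exact Submodule.smul_mem _ _ (Submodule.mem_span_singleton_self a)
    have hinj := Finite.injective_iff_surjective.2 hsurj
    have h0 : q = 0 := hinj (by simp only [smul_zero, ← hq, addOrderOf_nsmul_eq_zero])
    rw [h0, addOrderOf_zero] at hq
    exact hp.one_lt.ne hq

theorem not_dvd_idealIndex_of_add_smul {p : ℕ} (hp : p.Prime) {a y : M} (ha : a ≠ 0)
    (ha' : a + p • y ≠ 0) (h : ¬ p ∣ idealIndex M a) : ¬ p ∣ idealIndex M (a + p • y) := by
  rw [not_dvd_idealIndex_iff hp ha] at h
  rw [not_dvd_idealIndex_iff hp ha']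
  intro x
  obtain ⟨c, v, rfl⟩ := h x
  refine ⟨c, v - c • y, ?_⟩
  rw [smul_add, smul_sub, smul_comm c p y]
  abel

theorem not_dvd_idealIndex_add_smul_iff {p : ℕ} (hp : p.Prime) {a y : M} (ha : a ≠ 0)
    (ha' : a + p • y ≠ 0) : ¬ p ∣ idealIndex M (a + p • y) ↔ ¬ p ∣ idealIndex M a := by
  refine ⟨fun h => ?_, not_dvd_idealIndex_of_add_smul hp ha ha'⟩
  have := not_dvd_idealIndex_of_add_smul hp (y := -y) ha' (by simpa using ha) h
  simpa using this

end Index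

/-! ### Geometry of the cone and the parallelogram -/

section Cone

variable {k : Type*} [Field k] [NumberField k]

theorem cone_ne_zero {τ₁ τ₂ a : k} (hlin : LinearIndependent ℚ ![τ₁, τ₂])
    (ha : a ∈ cone τ₁ τ₂) : a ≠ 0 := by
  rintro rfl
  obtain ⟨l, m, hl, -, h⟩ := ha
  exact hl.ne' (LinearIndependent.pair_iff.1 hlin l m h.symm).1

theorem parallelogram_subset_cone {τ₁ τ₂ : k} : parallelogram τ₁ τ₂ ⊆ cone τ₁ τ₂ := by
  rintro a ⟨l, m, hl, -, hm, -, h⟩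
  exact ⟨l, m, hl, hm, h⟩

theorem cone_nsmul {p : ℕ} (hp : 0 < p) (τ₁ τ₂ : k) :
    cone (p • τ₁) (p • τ₂) = cone τ₁ τ₂ := by
  have hp' : (0 : ℚ) < p := by exact_mod_cast hp
  have hpk : (p : k) ≠ 0 := by exact_mod_cast hp.ne'
  ext a
  constructor
  · rintro ⟨l, m, hl, hm, rfl⟩
    refine ⟨l * p, m * p, by positivity, by positivity, ?_⟩
    simp only [Algebra.smul_def, eq_natCast, map_mul, map_natCast]
    ring
  · rintro ⟨l, m, hl, hm, rfl⟩
    refine ⟨l / p, m / p, by positivity, by positivity, ?_⟩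
    simp only [Algebra.smul_def, eq_natCast, map_div₀, map_natCast]
    field_simp

theorem add_nsmul_mem_cone {α β a : k} (ha : a ∈ cone α β) (m n : ℕ) :
    a + m • α + n • β ∈ cone α β := by
  obtain ⟨l, r, hl, hr, rfl⟩ := ha
  refine ⟨l + m, r + n, by positivity, by positivity, ?_⟩
  simp only [Algebra.smul_def, eq_natCast, map_add, map_natCast]
  ring

theorem exists_parallelogram_add {α β a : k} (ha : a ∈ cone α β) :
    ∃ m n : ℕ, a - m • α - n • β ∈ parallelogram α β := by
  obtain ⟨l, r, hl, hr, rfl⟩ := ha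
  -- The first coordinate must end in `(0, 1]`, so `⌈l⌉ - 1` is subtracted; the second must end in
  -- `[0, 1)`, so the floor is.
  have h1 : (0 : ℤ) ≤ ⌈l⌉ - 1 := by
    have := Int.ceil_pos.2 hl
    omega
  obtain ⟨m, hm⟩ := Int.eq_ofNat_of_zero_le h1
  have hm' : (m : ℚ) = ⌈l⌉ - 1 := by exact_mod_cast hm.symm
  refine ⟨m, ⌊r⌋₊, l - m, r - ⌊r⌋₊, ?_, ?_, ?_, ?_, ?_⟩
  · linarith [Int.ceil_lt_add_one l]
  · linarith [Int.le_ceil l]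
  · linarith [Nat.floor_le hr]
  · linarith [Nat.lt_floor_add_one r]
  · simp only [Algebra.smul_def, eq_natCast, map_sub, map_natCast]
    ring

theorem parallelogram_add_injective {α β a a' : k} (hlin : LinearIndependent ℚ ![α, β])
    (ha : a ∈ parallelogram α β) (ha' : a' ∈ parallelogram α β) {m n m' n' : ℕ}
    (h : a + m • α + n • β = a' + m' • α + n' • β) : m = m' ∧ n = n' := by
  obtain ⟨l, r, hl0, hl1, hr0, hr1, rfl⟩ := ha
  obtain ⟨l', r', hl0', hl1', hr0', hr1', rfl⟩ := ha'
  have := LinearIndependent.pair_iff.1 hlin (l + m - (l' + m')) (r + n - (r' + n')) (by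
    simp only [Algebra.smul_def, eq_natCast, map_sub, map_add, map_natCast] at h ⊢
    linear_combination h)
  obtain ⟨e1, e2⟩ := this
  constructor
  · have u1 : (m : ℚ) < m' + 1 := by linarith
    have u2 : (m' : ℚ) < m + 1 := by linarith
    have u1' : m < m' + 1 := by exact_mod_cast u1
    have u2' : m' < m + 1 := by exact_mod_cast u2
    omega
  · have u1 : (n : ℚ) < n' + 1 := by linarith
    have u2 : (n' : ℚ) < n + 1 := by linarith
    have u1' : n < n' + 1 := by exact_mod_cast u1
    have u2' : n' < n + 1 := by exact_mod_cast u2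
    omega

theorem TotallyPositive.of_mem_cone {α β a : k} (hα : TotallyPositive α) (hβ : TotallyPositive β)
    (ha : a ∈ cone α β) : TotallyPositive a := by
  obtain ⟨l, r, hl, hr, rfl⟩ := ha
  intro σ
  have h1 := hα σ
  have h2 := hβ σ
  have hl' : (0 : ℝ) < l := by exact_mod_cast hl
  have hr' : (0 : ℝ) ≤ r := by exact_mod_cast hr
  simp only [Algebra.smul_def, map_add, map_mul, eq_ratCast, map_ratCast]
  positivity

theorem TotallyPositive.nsmul {a : k} (ha : TotallyPositive a) {p : ℕ} (hp : 0 < p) :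
    TotallyPositive (p • a) := fun σ => by
  rw [map_nsmul]
  exact nsmul_pos (ha σ) hp.ne'

/-- A common denominator `y` makes `M` integral, and the parallelogram bounds all conjugates; only
finitely many algebraic integers of `k` satisfy such bounds. -/
theorem finite_parallelogram (M : Submodule (𝓞 k) k) [Module.Finite (𝓞 k) M] (α β : k) :
    {a : M | (a : k) ∈ parallelogram α β}.Finite := by
  classical
  obtain ⟨s, hs⟩ := Module.Finite.fg_top (R := 𝓞 k) (M := M)
  obtain ⟨y, hy, hint⟩ := exists_integral_multiples ℤ ℚ (L := k) (s.image Subtype.val)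
  have hint' (a : M) : IsIntegral ℤ (y • (a : k)) := by
    have ha : a ∈ Submodule.span (𝓞 k) (s : Set M) := hs ▸ Submodule.mem_top
    induction ha using Submodule.span_induction with
    | mem x hx => exact hint _ (Finset.mem_image_of_mem _ hx)
    | zero => simpa using isIntegral_zero
    | add x z _ _ hx hz => simpa using hx.add hz
    | smul c x _ hx =>
      rw [Submodule.coe_smul, smul_comm, Algebra.smul_def]
      exact c.isIntegral_coe.mul hx
  have hfin := NumberField.Embeddings.finite_of_norm_le k ℂ
    (∑ φ : k →+* ℂ, ‖(y : ℂ)‖ * (‖φ α‖ + ‖φ β‖))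
  have hinj : Function.Injective fun a : M => y • (a : k) := fun a b h =>
    Subtype.ext (smul_right_injective k hy h)
  refine (hfin.preimage hinj.injOn).subset ?_
  rintro a ⟨l, r, hl0, hl1, hr0, hr1, h⟩
  refine ⟨hint' a, fun φ => ?_⟩
  refine le_trans ?_ (Finset.single_le_sum (f := fun φ : k →+* ℂ => ‖(y : ℂ)‖ * (‖φ α‖ + ‖φ β‖))
    (fun φ _ => by positivity) (Finset.mem_univ φ))
  dsimp only
  rw [h, map_zsmul, zsmul_eq_mul, norm_mul]
  gcongr
  have n1 : ‖(l : ℂ)‖ ≤ 1 := by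
    rw [Complex.norm_ratCast, abs_of_pos (by exact_mod_cast hl0)]
    exact_mod_cast hl1
  have n2 : ‖(r : ℂ)‖ ≤ 1 := by
    rw [Complex.norm_ratCast, abs_of_nonneg (by exact_mod_cast hr0)]
    exact_mod_cast hr1.le
  simp only [Algebra.smul_def, map_add, map_mul, eq_ratCast, map_ratCast]
  refine (norm_add_le _ _).trans (add_le_add ?_ ?_)
  · rw [norm_mul]
    exact mul_le_of_le_one_left (norm_nonneg _) n1
  · rw [norm_mul]
    exact mul_le_of_le_one_left (norm_nonneg _) n2

end Cone

/-! ### Values of the character -/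

section Character

variable {k : Type*} [Field k]

theorem character_pow_eq_one {M : Submodule (𝓞 k) k} {ξ : AddChar M ℂ} {f : ℕ}
    (hf : (annihilator M ξ).comap (algebraMap ℤ (𝓞 k)) = Ideal.span {(f : ℤ)}) (x : M) :
    ξ x ^ f = 1 := by
  have h : ((f : ℤ)) ∈ (annihilator M ξ).comap (algebraMap ℤ (𝓞 k)) :=
    hf ▸ Ideal.mem_span_singleton_self _
  have h' : ξ (((f : ℕ) : 𝓞 k) • x) = 1 := by
    simpa using Ideal.mem_comap.1 h x
  rwa [Nat.cast_smul_eq_nsmul, AddChar.map_nsmul_eq_pow] at h'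

/-- If `f = pg`, write `1 = pc + v` with `v ∈ 𝔣`. Then `g = cf + gv` lies in `𝔣`, although `0 < g <
f`. -/
theorem coprime_of_isCoprime {𝔣 : Ideal (𝓞 k)} {f p : ℕ} (hf0 : 0 < f)
    (hf : 𝔣.comap (algebraMap ℤ (𝓞 k)) = Ideal.span {(f : ℤ)}) (hp : p.Prime)
    (hpf : IsCoprime (Ideal.span {(p : 𝓞 k)}) 𝔣) : p.Coprime f := by
  rw [Nat.Prime.coprime_iff_not_dvd hp]
  rintro ⟨g, rfl⟩
  have hmem (n : ℕ) : (n : 𝓞 k) ∈ 𝔣 ↔ ((p * g : ℕ) : ℤ) ∣ n := by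
    rw [← Ideal.mem_span_singleton, ← hf, Ideal.mem_comap]
    simp
  obtain ⟨u, hu, v, hv, huv⟩ := Ideal.isCoprime_iff_exists.1 hpf
  obtain ⟨c, rfl⟩ := Ideal.mem_span_singleton.1 hu
  have hg : (g : 𝓞 k) ∈ 𝔣 := by
    have e : (g : 𝓞 k) = c * ((p * g : ℕ) : 𝓞 k) + g * v := by
      push_cast
      linear_combination -(g : 𝓞 k) * huv
    rw [e]
    exact add_mem (Ideal.mul_mem_left _ _ ((hmem _).2 dvd_rfl)) (Ideal.mul_mem_left _ _ hv)
  have hdvd := Int.natCast_dvd_natCast.1 ((hmem g).1 hg)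
  have hg0 : 0 < g := Nat.pos_of_ne_zero (by rintro rfl; simp at hf0)
  have := Nat.le_of_dvd hg0 hdvd
  have := hp.two_le
  nlinarith

theorem pow_ne_one_of_coprime {z : ℂ} {f p : ℕ} (hpf : p.Coprime f) (hz : z ^ f = 1)
    (hz1 : z ≠ 1) : z ^ p ≠ 1 := fun h => hz1 <| by
  have := pow_gcd_eq_one.2 ⟨h, hz⟩
  rwa [hpf.gcd_eq_one, pow_one] at this

end Character

/-! ### The norm form and its rationality -/

section Norm

variable {k : Type*} [Field k] [NumberField k]

/-- The two real embeddings remain distinct in `ℂ`, and in degree 2 there are no further complex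
embeddings. -/
theorem embeddings_mul_eq_norm (hdeg : Module.finrank ℚ k = 2) (ι : Fin 2 ≃ (k →+* ℝ)) (x : k) :
    ι 0 x * ι 1 x = ((Algebra.norm ℚ x : ℚ) : ℝ) := by
  have hfin : Finite (k →+* ℝ) := Finite.of_equiv _ ι
  have hinj : Function.Injective fun i => (algebraMap ℝ ℂ).comp (ι i) := fun i j h =>
    ι.injective (RingHom.ext fun x => Complex.ofReal_injective (RingHom.congr_fun h x))
  have hbij : Function.Bijective fun i => (algebraMap ℝ ℂ).comp (ι i) :=
    (Fintype.bijective_iff_injective_and_card _).2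
      ⟨hinj, by rw [NumberField.Embeddings.card, hdeg, Fintype.card_fin]⟩
  have h := Algebra.norm_eq_prod_embeddings ℚ ℂ x
  rw [← (RingHom.equivRatAlgHom k ℂ).prod_comp, ← (Equiv.ofBijective _ hbij).prod_comp,
    Fin.prod_univ_two] at h
  have h' : ((Algebra.norm ℚ x : ℚ) : ℂ) = (ι 0 x : ℂ) * (ι 1 x : ℂ) := h
  have h'' : (((Algebra.norm ℚ x : ℚ) : ℝ) : ℂ) = ((ι 0 x * ι 1 x : ℝ) : ℂ) := by
    push_cast
    exact h'
  exact (Complex.ofReal_injective h'').symm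

/-- The mixed difference at the origin of `(m, m') ↦ N(x + m α + m' β) ^ n`. -/
def normDiff (x α β : k) (n j l : ℕ) : ℚ :=
  ∑ i ∈ range (j + 1), ((-1 : ℤ) ^ (j - i) * j.choose i : ℤ) *
    ∑ i' ∈ range (l + 1), ((-1 : ℤ) ^ (l - i') * l.choose i' : ℤ) *
      Algebra.norm ℚ (x + i • α + i' • β) ^ n

/-- The right-hand side is rational and free of `ι`, which yields both membership in `ℚ(μ_f)` and
independence of the ordering. -/
theorem mixedDiff_normFormPow_eq (hdeg : Module.finrank ℚ k = 2) (ι : Fin 2 ≃ (k →+* ℝ))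
    (x α β : k) (n j l : ℕ) :
    mixedDiff (normFormPow (embVec ι x) (embVec ι α) (embVec ι β) n) j l 0 =
      (normDiff x α β n j l : ℂ) := by
  rw [mixedDiff_eq_sum, normDiff]
  push_cast
  refine sum_congr rfl fun i _ => ?_
  rw [fwdDiff_iter_eq_sum_shift]
  congr 1
  refine sum_congr rfl fun i' _ => ?_
  rw [zsmul_eq_mul]
  push_cast
  congr 1
  have h := embeddings_mul_eq_norm hdeg ι (x + i • α + i' • β)
  simp only [normFormPow, embVec]
  rw [← Complex.ofReal_ratCast, ← h]
  simp [mul_comm]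

end Norm

/-! ### Decomposition of the depleted cone -/

section Decomposition

variable {k : Type*} [Field k] [NumberField k] {M : Submodule (𝓞 k) k}

theorem linearIndependent_nsmul {p : ℕ} (hp : 0 < p) {τ₁ τ₂ : M}
    (hlin : LinearIndependent ℚ ![(τ₁ : k), (τ₂ : k)]) :
    LinearIndependent ℚ ![((p • τ₁ : M) : k), ((p • τ₂ : M) : k)] := by
  have hp' : (p : ℚ) ≠ 0 := by exact_mod_cast hp.ne'
  rw [LinearIndependent.pair_iff] at hlin ⊢
  intro s t h
  have := hlin (s * p) (t * p) (by
    simpa [mul_smul, Nat.cast_smul_eq_nsmul] using h)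
  simpa [hp'] using this

theorem mem_cone_of_mem_depletedParallelogram {p : ℕ} (hp : p.Prime) {τ₁ τ₂ a : M}
    (ha : a ∈ depletedParallelogram p M τ₁ τ₂) : (a : k) ∈ cone (τ₁ : k) (τ₂ : k) := by
  rw [← cone_nsmul hp.pos]
  simpa using parallelogram_subset_cone ha.1

/-- Total positivity is what allows the complex power of the product to be split over the two
embeddings. -/
theorem zetaTerm_add {ι : Fin 2 ≃ (k →+* ℝ)} (ξ : AddChar M ℂ) {a α β : M}
    (ha : TotallyPositive (a : k)) (hα : TotallyPositive (α : k)) (hβ : TotallyPositive (β : k))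
    (s : ℂ) (m n : ℕ) :
    zetaTerm ι M ξ s (a + m • α + n • β) = ξ a * (ξ α ^ m * ξ β ^ n *
      kernel (embVec ι (a : k)) (embVec ι (α : k)) (embVec ι (β : k)) s s m n) := by
  have hl (i : Fin 2) : ι i ((a + m • α + n • β : M) : k) =
      linForm (embVec ι (a : k)) (embVec ι (α : k)) (embVec ι (β : k)) i m n := by
    simp [linForm, embVec, mul_comm]
  have hpos (i : Fin 2) := linForm_pos (u := embVec ι (a : k)) (a := embVec ι (α : k))
    (b := embVec ι (β : k)) (fun i => ha (ι i)) (fun i => hα (ι i)) (fun i => hβ (ι i)) i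
    (Nat.cast_nonneg m) (Nat.cast_nonneg n)
  rw [zetaTerm, hl, hl, AddChar.map_add_eq_mul, AddChar.map_add_eq_mul, AddChar.map_nsmul_eq_pow,
    AddChar.map_nsmul_eq_pow, kernel, Complex.ofReal_mul,
    Complex.mul_cpow_ofReal_nonneg (hpos 0).le (hpos 1).le, Complex.cpow_neg, Complex.cpow_neg]
  rw [div_eq_mul_inv, mul_inv]
  ring

variable [Module.Finite (𝓞 k) M]

theorem mem_depletedCone_add_iff {p : ℕ} (hp : p.Prime) {τ₁ τ₂ : M}
    (hlin : LinearIndependent ℚ ![(τ₁ : k), (τ₂ : k)]) {a : M}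
    (ha : (a : k) ∈ cone (τ₁ : k) (τ₂ : k)) (m n : ℕ) :
    a + m • (p • τ₁) + n • (p • τ₂) ∈ depletedCone p M τ₁ τ₂ ↔ ¬ p ∣ idealIndex M a := by
  have hne {b : M} (hb : (b : k) ∈ cone (τ₁ : k) (τ₂ : k)) : b ≠ 0 := fun h =>
    cone_ne_zero hlin hb (by rw [h]; rfl)
  have hmem : ((a + m • (p • τ₁) + n • (p • τ₂) : M) : k) ∈ cone (τ₁ : k) (τ₂ : k) := by
    have := add_nsmul_mem_cone ha (m * p) (n * p)
    simpa [mul_smul] using this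
  have e : a + m • (p • τ₁) + n • (p • τ₂) = a + p • (m • τ₁ + n • τ₂) := by
    rw [smul_add, smul_comm p m, smul_comm p n, add_assoc]
  have hmem' := hne hmem
  rw [e] at hmem'
  rw [depletedCone, Set.mem_ofPred_eq, and_iff_right hmem, e,
    not_dvd_idealIndex_add_smul_iff hp (hne ha) hmem']

/-- The depleted cone is the disjoint union of the translates of the depleted parallelogram by
the monoid generated by `p τ₁` and `p τ₂`. -/
def depletedConeEquiv {p : ℕ} (hp : p.Prime) {τ₁ τ₂ : M}
    (hlin : LinearIndependent ℚ ![(τ₁ : k), (τ₂ : k)]) :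
    depletedParallelogram p M τ₁ τ₂ × (ℕ × ℕ) ≃ depletedCone p M τ₁ τ₂ :=
  Equiv.ofBijective (fun x => ⟨x.1 + x.2.1 • (p • τ₁) + x.2.2 • (p • τ₂),
    (mem_depletedCone_add_iff hp hlin (mem_cone_of_mem_depletedParallelogram hp x.1.2) _ _).2
      x.1.2.2⟩) <| by
    constructor
    · rintro ⟨a, m, n⟩ ⟨a', m', n'⟩ h
      have h1 : (a : M) + m • (p • τ₁) + n • (p • τ₂) =
          (a' : M) + m' • (p • τ₁) + n' • (p • τ₂) := congrArg Subtype.val h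
      obtain ⟨rfl, rfl⟩ := parallelogram_add_injective (linearIndependent_nsmul hp.pos hlin)
        a.2.1 a'.2.1 (congrArg (Subtype.val : M → k) h1)
      have : a = a' := Subtype.ext (add_right_cancel (add_right_cancel h1))
      rw [this]
    · rintro ⟨b, hb⟩
      have hb1 : (b : k) ∈ cone ((p • τ₁ : M) : k) ((p • τ₂ : M) : k) := by
        have := hb.1
        rw [← cone_nsmul hp.pos] at this
        simpa using this
      obtain ⟨m, n, hmn⟩ := exists_parallelogram_add hb1
      set a : M := b - m • (p • τ₁) - n • (p • τ₂) with ha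
      have hak : (a : k) ∈ parallelogram ((p • τ₁ : M) : k) ((p • τ₂ : M) : k) := hmn
      have hab : a + m • (p • τ₁) + n • (p • τ₂) = b := by rw [ha]; abel
      have hac : (a : k) ∈ cone (τ₁ : k) (τ₂ : k) := by
        rw [← cone_nsmul hp.pos]
        simpa using parallelogram_subset_cone hak
      have hidx := (mem_depletedCone_add_iff hp hlin hac m n).1 (hab.symm ▸ hb)
      exact ⟨(⟨a, hak, hidx⟩, m, n), Subtype.ext hab⟩

theorem depletedConeEquiv_apply {p : ℕ} (hp : p.Prime) {τ₁ τ₂ : M}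
    (hlin : LinearIndependent ℚ ![(τ₁ : k), (τ₂ : k)])
    (x : depletedParallelogram p M τ₁ τ₂ × (ℕ × ℕ)) :
    (depletedConeEquiv hp hlin x : M) = x.1 + x.2.1 • (p • τ₁) + x.2.2 • (p • τ₂) := rfl

theorem finite_depletedParallelogram (p : ℕ) (τ₁ τ₂ : M) :
    (depletedParallelogram p M τ₁ τ₂).Finite :=
  (finite_parallelogram M _ _).subset fun _ ha => ha.1

end Decomposition

/-! ### The depleted zeta function and the formal series -/

section Zeta

variable {k : Type*} [Field k] [NumberField k] {M : Submodule (𝓞 k) k} [Module.Finite (𝓞 k) M]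

/-- The depleted zeta function as a finite sum of Dirichlet series over `ℕ × ℕ`. -/
theorem summable_zetaTerm_and_depletedZeta_eq {ι : Fin 2 ≃ (k →+* ℝ)} {p : ℕ} (hp : p.Prime)
    {ξ : AddChar M ℂ} (hξ : ∀ x, ‖ξ x‖ = 1) {τ₁ τ₂ : M}
    (hpos₁ : TotallyPositive (τ₁ : k)) (hpos₂ : TotallyPositive (τ₂ : k))
    (hlin : LinearIndependent ℚ ![(τ₁ : k), (τ₂ : k)]) {s : ℂ} (hs : 1 < s.re) :
    (Summable fun a : depletedCone p M τ₁ τ₂ => ‖zetaTerm ι M ξ s a‖) ∧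
    depletedZeta ι p M ξ τ₁ τ₂ s = ∑ a ∈ (finite_depletedParallelogram p τ₁ τ₂).toFinset,
      ξ a * coneSum (embVec ι (a : k)) (embVec ι ((p • τ₁ : M) : k))
        (embVec ι ((p • τ₂ : M) : k)) (ξ (p • τ₁)) (ξ (p • τ₂)) s := by
  have hα : TotallyPositive ((p • τ₁ : M) : k) := by simpa using hpos₁.nsmul hp.pos
  have hβ : TotallyPositive ((p • τ₂ : M) : k) := by simpa using hpos₂.nsmul hp.pos
  have ha (a : depletedParallelogram p M τ₁ τ₂) : TotallyPositive ((a : M) : k) :=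
    hpos₁.of_mem_cone hpos₂ (mem_cone_of_mem_depletedParallelogram hp a.2)
  have hterm (x : depletedParallelogram p M τ₁ τ₂ × (ℕ × ℕ)) :=
    (congrArg (zetaTerm ι M ξ s) (depletedConeEquiv_apply hp hlin x)).trans
      (zetaTerm_add (ι := ι) ξ (ha x.1) hα hβ s x.2.1 x.2.2)
  have hfin : Fintype (depletedParallelogram p M τ₁ τ₂) :=
    (finite_depletedParallelogram p τ₁ τ₂).fintype
  have hsum : Summable fun x => ‖zetaTerm ι M ξ s (depletedConeEquiv hp hlin x)‖ := by
    rw [summable_prod_of_nonneg fun x => norm_nonneg _]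
    refine ⟨fun a => ?_, Summable.of_finite⟩
    have hk := (summable_kernel (u := embVec ι (a : k)) (a := embVec ι ((p • τ₁ : M) : k))
      (b := embVec ι ((p • τ₂ : M) : k)) (fun i => ha a (ι i)) (fun i => hα (ι i))
      (fun i => hβ (ι i)) hs).norm
    refine hk.congr fun m => ?_
    rw [hterm, norm_mul, norm_mul, norm_mul, norm_pow, norm_pow, hξ, hξ, hξ]
    simp
  refine ⟨(depletedConeEquiv hp hlin).summable_iff.1 hsum, ?_⟩
  rw [depletedZeta, ← (depletedConeEquiv hp hlin).tsum_eq, hsum.of_norm.tsum_prod, tsum_fintype,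
    Finset.sum_subtype (finite_depletedParallelogram p τ₁ τ₂).toFinset
      (p := (· ∈ depletedParallelogram p M τ₁ τ₂)) (fun a => Set.Finite.mem_toFinset _)
      (f := fun a : M => ξ a * coneSum (embVec ι (a : k)) (embVec ι ((p • τ₁ : M) : k))
        (embVec ι ((p • τ₂ : M) : k)) (ξ (p • τ₁)) (ξ (p • τ₂)) s)]
  refine sum_congr rfl fun a _ => ?_
  rw [coneSum, ← tsum_mul_left]
  exact tsum_congr fun m => hterm (a, m)

/-- The value of the depleted zeta function at `-n`, computed by Abel summation of order `K`. -/
def depletedValue (p : ℕ) (ξ : AddChar M ℂ) (τ₁ τ₂ : M) (n K : ℕ) : ℂ :=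
  ∑ a ∈ (finite_depletedParallelogram p τ₁ τ₂).toFinset, ξ a *
    ∑ j ∈ range K, ∑ l ∈ range K, abelCoeff (ξ (p • τ₁)) j * abelCoeff (ξ (p • τ₂)) l *
      (normDiff (a : k) ((p • τ₁ : M) : k) ((p • τ₂ : M) : k) n j l : ℂ)

theorem exists_entire_depletedZeta (hdeg : Module.finrank ℚ k = 2) (ι : Fin 2 ≃ (k →+* ℝ)) {p : ℕ}
    (hp : p.Prime) {ξ : AddChar M ℂ} (hξ : ∀ x, ‖ξ x‖ = 1) {τ₁ τ₂ : M}
    (hpos₁ : TotallyPositive (τ₁ : k)) (hpos₂ : TotallyPositive (τ₂ : k))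
    (hlin : LinearIndependent ℚ ![(τ₁ : k), (τ₂ : k)])
    (h₁ : ξ (p • τ₁) ≠ 1) (h₂ : ξ (p • τ₂) ≠ 1) :
    ∃ Z : ℂ → ℂ, Differentiable ℂ Z ∧
      (∀ s : ℂ, 1 < s.re → Z s = depletedZeta ι p M ξ τ₁ τ₂ s) ∧
      ∀ n K : ℕ, 2 * n + 2 < K → Z (-n) = depletedValue p ξ τ₁ τ₂ n K := by
  have hα : TotallyPositive ((p • τ₁ : M) : k) := by simpa using hpos₁.nsmul hp.pos
  have hβ : TotallyPositive ((p • τ₂ : M) : k) := by simpa using hpos₂.nsmul hp.pos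
  have ha (a : M) (h : a ∈ depletedParallelogram p M τ₁ τ₂) : TotallyPositive (a : k) :=
    hpos₁.of_mem_cone hpos₂ (mem_cone_of_mem_depletedParallelogram hp h)
  choose! Z hZ hZs hZn using fun (a : M) (h : a ∈ depletedParallelogram p M τ₁ τ₂) =>
    exists_entire_coneSum (u := embVec ι (a : k)) (a := embVec ι ((p • τ₁ : M) : k))
      (b := embVec ι ((p • τ₂ : M) : k)) (fun i => ha a h (ι i)) (fun i => hα (ι i))
      (fun i => hβ (ι i)) (hξ _).le h₁ (hξ _).le h₂
  refine ⟨fun s => ∑ a ∈ (finite_depletedParallelogram p τ₁ τ₂).toFinset, ξ a * Z a s,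
    Differentiable.fun_sum fun a h => (hZ a (by simpa using h)).const_mul _, fun s hs => ?_,
    fun n K hK => ?_⟩
  · rw [(summable_zetaTerm_and_depletedZeta_eq hp hξ hpos₁ hpos₂ hlin hs).2]
    exact sum_congr rfl fun a h => by rw [hZs a (by simpa using h) s hs]
  · refine sum_congr rfl fun a h => ?_
    rw [hZn a (by simpa using h) n K hK]
    simp only [mixedDiff_normFormPow_eq hdeg]

theorem constantCoeff_Delta_iterate_depletedSeries (hdeg : Module.finrank ℚ k = 2)
    (ι : Fin 2 ≃ (k →+* ℝ)) {p : ℕ} {ξ : AddChar M ℂ} {τ₁ τ₂ : M}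
    (h₁ : ξ (p • τ₁) ≠ 1) (h₂ : ξ (p • τ₂) ≠ 1) {n K : ℕ} (hK : 2 * n < K) :
    MvPowerSeries.constantCoeff (Delta^[n] (depletedSeries ι p M ξ τ₁ τ₂)) =
      depletedValue p ξ τ₁ τ₂ n K := by
  rw [← deltaValue_apply, depletedSeries,
    finsum_mem_eq_finite_toFinset_sum _ (finite_depletedParallelogram p τ₁ τ₂), sum_mul, map_sum]
  refine sum_congr rfl fun a _ => ?_
  rw [smul_mul_assoc, map_smul, smul_eq_mul, deltaValue_cone_series (hasExponent_onePlusXPow _)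
    (hasExponent_onePlusXPow _) (hasExponent_onePlusXPow _) h₁ h₂ hK]
  congr 1
  refine sum_congr rfl fun j _ => sum_congr rfl fun l _ => ?_
  rw [← mixedDiff_normFormPow_eq hdeg ι, mixedDiff]

theorem abelCoeff_mem {F : IntermediateField ℚ ℂ} {z : ℂ} (hz : z ∈ F) (j : ℕ) :
    abelCoeff z j ∈ F :=
  div_mem (pow_mem (div_mem hz (sub_mem (one_mem _) hz)) _) (sub_mem (one_mem _) hz)

theorem depletedValue_mem {p f : ℕ} {ξ : AddChar M ℂ} (hξ : ∀ x, ξ x ^ f = 1) (τ₁ τ₂ : M)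
    (n K : ℕ) : depletedValue p ξ τ₁ τ₂ n K ∈ cyclotomicSubfield f := by
  have h (x : M) : ξ x ∈ cyclotomicSubfield f := IntermediateField.subset_adjoin _ _ (hξ x)
  refine sum_mem fun a _ => mul_mem (h a) (sum_mem fun j _ => sum_mem fun l _ => ?_)
  exact mul_mem (mul_mem (abelCoeff_mem (h _) j) (abelCoeff_mem (h _) l))
    (SubfieldClass.ratCast_mem _ _)

end Zeta

end ConeZeta

end

/-! ### The main theorem -/

theorem mainTheorem5 {k : Type*} [Field k] [NumberField k]
    (hdeg : Module.finrank ℚ k = 2) (hreal : NumberField.IsTotallyReal k)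
    (ι : Fin 2 ≃ (k →+* ℝ))
    (𝔣 : Ideal (𝓞 k)) (h𝔣 : 𝔣 ≠ ⊤)
    (f : ℕ) (hf0 : 0 < f) (hf : 𝔣.comap (algebraMap ℤ (𝓞 k)) = Ideal.span {(f : ℤ)})
    (I : FractionalIdeal (𝓞 k)⁰ k) (hI : I ≠ 0)
    (ξ : AddChar (I : Submodule (𝓞 k) k) ℂ) (hξ : ∀ a, IsOfFinOrder (ξ a))
    (hann : ConeZeta.annihilator (I : Submodule (𝓞 k) k) ξ = 𝔣)
    (τ₁ τ₂ : (I : Submodule (𝓞 k) k))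
    (hpos₁ : ConeZeta.TotallyPositive (τ₁ : k)) (hpos₂ : ConeZeta.TotallyPositive (τ₂ : k))
    (hker₁ : ξ τ₁ ≠ 1) (hker₂ : ξ τ₂ ≠ 1)
    (hlin : LinearIndependent ℚ ![(τ₁ : k), (τ₂ : k)])
    (p : ℕ) (hp : p.Prime) (hpf : IsCoprime (Ideal.span {(p : 𝓞 k)}) 𝔣) :
    -- the series `F` is well defined: finite numerator, invertible denominator
    ((ConeZeta.depletedParallelogram p (I : Submodule (𝓞 k) k) τ₁ τ₂).Finite ∧
      ξ (p • τ₁) ≠ 1 ∧ ξ (p • τ₂) ≠ 1) ∧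
    -- absolute convergence and analyticity for `Re s > 1`
    (∀ s : ℂ, 1 < s.re →
      Summable fun a : ConeZeta.depletedCone p (I : Submodule (𝓞 k) k) τ₁ τ₂ =>
        ‖ConeZeta.zetaTerm ι (I : Submodule (𝓞 k) k) ξ s a‖) ∧
    AnalyticOnNhd ℂ (ConeZeta.depletedZeta ι p (I : Submodule (𝓞 k) k) ξ τ₁ τ₂)
      {s : ℂ | 1 < s.re} ∧
    -- meromorphic continuation, and its values at the integers `m = -n ≤ 0`
    ∃ Z : ℂ → ℂ, Meromorphic Z ∧
      (∀ s : ℂ, 1 < s.re →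
        Z s = ConeZeta.depletedZeta ι p (I : Submodule (𝓞 k) k) ξ τ₁ τ₂ s) ∧
      ∀ n : ℕ, AnalyticAt ℂ Z (-(n : ℂ)) ∧
        (∀ ι' : Fin 2 ≃ (k →+* ℝ),
          Z (-(n : ℂ)) = MvPowerSeries.constantCoeff
            (ConeZeta.Delta^[n]
              (ConeZeta.depletedSeries ι' p (I : Submodule (𝓞 k) k) ξ τ₁ τ₂))) ∧
        Z (-(n : ℂ)) ∈ ConeZeta.cyclotomicSubfield f := by
  have hnoeth : IsNoetherian (𝓞 k) (I : Submodule (𝓞 k) k) := FractionalIdeal.isNoetherian I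
  have hfin : Module.Finite (𝓞 k) (I : Submodule (𝓞 k) k) := inferInstance
  subst hann
  have hroot := ConeZeta.character_pow_eq_one hf
  have hcop := ConeZeta.coprime_of_isCoprime hf0 hf hp hpf
  have hnorm (x) : ‖ξ x‖ = 1 := Complex.norm_eq_one_of_pow_eq_one (hroot x) hf0.ne'
  have h₁ : ξ (p • τ₁) ≠ 1 := by
    rw [AddChar.map_nsmul_eq_pow]
    exact ConeZeta.pow_ne_one_of_coprime hcop (hroot _) hker₁
  have h₂ : ξ (p • τ₂) ≠ 1 := by
    rw [AddChar.map_nsmul_eq_pow]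
    exact ConeZeta.pow_ne_one_of_coprime hcop (hroot _) hker₂
  obtain ⟨Z, hZ, hZs, hZn⟩ :=
    ConeZeta.exists_entire_depletedZeta hdeg ι hp hnorm hpos₁ hpos₂ hlin h₁ h₂
  have hopen : IsOpen {s : ℂ | 1 < s.re} := isOpen_lt continuous_const Complex.continuous_re
  refine ⟨⟨ConeZeta.finite_depletedParallelogram p τ₁ τ₂, h₁, h₂⟩, fun s hs =>
    (ConeZeta.summable_zetaTerm_and_depletedZeta_eq hp hnorm hpos₁ hpos₂ hlin hs).1,
    (hZ.differentiableOn.congr fun s hs => (hZs s hs).symm).analyticOnNhd hopen,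
    Z, fun s => (hZ.analyticAt s).meromorphicAt, hZs, fun n => ⟨hZ.analyticAt _, fun ι' => ?_, ?_⟩⟩
  -- `2n + 3` is the least order exceeding `2n + 2`; the same order on both sides makes the two
  -- finite sums literally equal.
  · rw [hZn n (2 * n + 3) (by omega),
      ConeZeta.constantCoeff_Delta_iterate_depletedSeries hdeg ι' h₁ h₂ (K := 2 * n + 3) (by omega)]
  · rw [hZn n (2 * n + 3) (by omega)]
    exact ConeZeta.depletedValue_mem hroot τ₁ τ₂ n _
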